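/- All graphs are finite, simple and undirected. Let $H$ be a connected graph with at least three vertices. There is an algorithm that, given an integer $n\ge 1$, runs in time polynomial in $n$ (the polynomial may depend on $H$) and outputs a graph $G$ and a vertex set $S\subseteq V(G)$ of size $n$ such that all of the following hold: 1. $\mathrm{tw}(G)\le \mathrm{tw}(H)$; 2. $G$ contains $3n-1$ pairwise vertex-disjoint subgraphs isomorphic to $H$; 3. $G-S$ contains $3n-2$ pairwise vertex-disjoint subgraphs isomorphic to $H$; 4. for every $v\in S$ there is a set $X\subseteq V(G)$ of size $3n-1$ such that (a) $v\in X$; (b) $G-X$ does not contain $H$ as a minor; (c) every connected component of $\mathrm{slb}(H)\text{-}\mathrm{prune}(G-X)$ is a minor of $H$; (d) every connected component $C$ of $G-X$ that contains a vertex of $S$ satisfies $|V(C)|<\mathrm{slb}(H)$ and contains exactly one vertex of $S$. Here $\mathrm{tw}$ denotes treewidth. A cut vertex of a graph is a vertex whose removal increases the number of connected components; a graph is biconnected if it is connected and has no cut vertex; a leaf-block of $H$ is a maximal biconnected subgraph of $H$ that contains at most one cut vertex of $H$; and $\mathrm{slb}(H)$ is the number of vertices of a smallest leaf-block of $H$.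 For an integer $\alpha$, a graph $F$ is $\alpha$-robust if $|V(F)|\ge\alpha$ and there is no vertex $v$ of $F$ such that $F-v$ has a connected component with fewer than $\alpha-1$ vertices; $\alpha\text{-}\mathrm{prune}(F)$ is the unique maximal $\alpha$-robust subgraph of $F$ (the empty graph if $F$ has no $\alpha$-robust subgraph). -/

import Mathlib

namespace ClauseGadget

/-! ### Deleting vertices, minors, packings -/

/-- `G - X`: the subgraph of `G` induced by the vertices outside `X`. -/
abbrev minus {V : Type*} (G : SimpleGraph V) (X : Set V) : SimpleGraph {v : V // v ∉ X} :=
  G.induce {v : V | v ∉ X}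

/-- `φ` is an `H`-model in `G`: the branch sets `φ v` induce connected (in particular nonempty)
subgraphs of `G`, are pairwise disjoint, and every edge of `H` is realised by an edge of `G`
between the corresponding branch sets. -/
structure IsModel {V W : Type*} (H : SimpleGraph V) (G : SimpleGraph W) (φ : V → Set W) :
    Prop where
  connected : ∀ v, (G.induce (φ v)).Connected
  edge : ∀ u v, H.Adj u v → ∃ u' ∈ φ u, ∃ v' ∈ φ v, G.Adj u' v'
  disjoint : ∀ u v, u ≠ v → Disjoint (φ u) (φ v)

/-- `H` is a minor of `G`. -/
def IsMinor {V W : Type*} (H : SimpleGraph V) (G : SimpleGraph W) : Prop :=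
  ∃ φ : V → Set W, IsModel H G φ

/-- `H` is a component-wise minor of `G`: every connected component of `H` is a minor of `G`. -/
def IsCompMinor {V W : Type*} (H : SimpleGraph V) (G : SimpleGraph W) : Prop :=
  ∀ c : H.ConnectedComponent, IsMinor (H.induce c.supp) G

/-- `G` contains `k` pairwise vertex-disjoint (not necessarily induced) subgraphs
isomorphic to `H`. -/
def HasPacking {V W : Type*} (H : SimpleGraph V) (G : SimpleGraph W) (k : ℕ) : Prop :=
  ∃ f : Fin k → SimpleGraph.Copy H G,
    ∀ i j, i ≠ j → Disjoint (Set.range (f i)) (Set.range (f j))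

/-! ### Treewidth -/

/-- `(T, bag)` is a tree decomposition of `G`. -/
structure IsTreeDecomposition {W ι : Type*} (G : SimpleGraph W) (T : SimpleGraph ι)
    (bag : ι → Finset W) : Prop where
  isTree : T.IsTree
  vertex : ∀ v, ∃ i, v ∈ bag i
  edge : ∀ u v, G.Adj u v → ∃ i, u ∈ bag i ∧ v ∈ bag i
  connected : ∀ v, (T.induce {i | v ∈ bag i}).Connected

/-- The treewidth of a finite graph: the least `k` for which there is a tree decomposition, over a
finite tree, all of whose bags have at most `k + 1` vertices. -/
noncomputable def treewidth {W : Type*} [Finite W] (G : SimpleGraph W) : ℕ :=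
  sInf {k | ∃ (m : ℕ) (T : SimpleGraph (Fin m)) (bag : Fin m → Finset W),
    IsTreeDecomposition G T bag ∧ ∀ i, (bag i).card ≤ k + 1}

/-! ### Cut vertices and leaf-blocks -/

/-- Removing the vertex `v` increases the number of connected components. -/
def IsCutVertex {V : Type*} [Finite V] (G : SimpleGraph V) (v : V) : Prop :=
  Nat.card G.ConnectedComponent < Nat.card (minus G {v}).ConnectedComponent

/-- A graph is biconnected if it is connected and has no cut vertex. -/
def IsBiconnected {V : Type*} [Finite V] (G : SimpleGraph V) : Prop :=
  G.Connected ∧ ∀ v, ¬ IsCutVertex G v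

/-- A biconnected component is a maximal biconnected subgraph. -/
def IsBiconnectedComponent {V : Type*} [Finite V] (G : SimpleGraph V) (B : G.Subgraph) : Prop :=
  Maximal (fun K : G.Subgraph => IsBiconnected K.coe) B

/-- A leaf-block of `G` is a biconnected component of `G` that contains at most one cut vertex
of `G`. -/
def IsLeafBlock {V : Type*} [Finite V] (G : SimpleGraph V) (B : G.Subgraph) : Prop :=
  IsBiconnectedComponent G B ∧ {v | v ∈ B.verts ∧ IsCutVertex G v}.ncard ≤ 1

/-- The number of vertices of a smallest leaf-block of `G` (every nonempty finite graph has a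
leaf-block). -/
noncomputable def slb {V : Type*} [Finite V] (G : SimpleGraph V) : ℕ :=
  sInf {k | ∃ B : G.Subgraph, IsLeafBlock G B ∧ B.verts.ncard = k}

/-! ### Robust graphs and pruning -/

/-- `G` is `α`-robust: it has at least `α` vertices, and for no vertex `v` does `G - v` have a
connected component with fewer than `α - 1` vertices. -/
def IsRobust {V : Type*} [Finite V] (α : ℕ) (G : SimpleGraph V) : Prop :=
  α ≤ Nat.card V ∧ ∀ v, ∀ c : (minus G {v}).ConnectedComponent, α ≤ c.supp.ncard + 1

/-- `α`-prune of `G`: the largest `α`-robust subgraph of `G`, or the empty subgraph if `G` has no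
`α`-robust subgraph. It is written here as the union of all `α`-robust subgraphs, which is itself
`α`-robust as soon as there is one, see `prune_isGreatest`. -/
noncomputable def prune {V : Type*} [Finite V] (α : ℕ) (G : SimpleGraph V) : G.Subgraph :=
  sSup {K : G.Subgraph | IsRobust α K.coe}

theorem prune_isGreatest {V : Type*} [Finite V] (α : ℕ) (G : SimpleGraph V)
    (h : ∃ K : G.Subgraph, IsRobust α K.coe) :
    IsGreatest {K : G.Subgraph | IsRobust α K.coe} (prune α G) := by
  refine ⟨?_, fun K hK => le_sSup hK⟩
  have le : ∀ K : G.Subgraph, IsRobust α K.coe → K ≤ prune α G := fun K hK => le_sSup hK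
  refine ⟨?_, ?_⟩
  · obtain ⟨K, hK⟩ := h
    exact hK.1.trans (Nat.card_mono (Set.toFinite _) (le K hK).1)
  · intro v c
    obtain ⟨x, rfl⟩ := c.exists_rep
    obtain ⟨⟨x, hxP⟩, hxv⟩ := x
    have hx' := hxP
    simp only [prune, SimpleGraph.Subgraph.verts_sSup, Set.mem_iUnion, Set.mem_ofPred_eq] at hx'
    obtain ⟨K, hK, hxK⟩ := hx'
    have hKP := le K hK
    by_cases hα : α ≤ 1
    · omega
    -- a vertex `u ≠ x` of `K` such that `K - u` lies in the pruned graph minus `v`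
    have hu : ∃ u : K.verts, u.1 ≠ x ∧ ∀ y : K.verts, y ≠ u → y.1 ≠ v.1 := by
      by_cases hv : v.1 ∈ K.verts
      · refine ⟨⟨v.1, hv⟩, fun e => hxv (Subtype.ext e.symm), fun y hy e => hy (Subtype.ext e)⟩
      · have : 1 < Nat.card K.verts := lt_of_lt_of_le (by omega) hK.1
        have := Finite.one_lt_card_iff_nontrivial.1 this
        obtain ⟨u, hu⟩ := exists_ne (⟨x, hxK⟩ : K.verts)
        exact ⟨u, fun e => hu (Subtype.ext e), fun y _ e => hv (e ▸ y.2)⟩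
    obtain ⟨u, hux, hu⟩ := hu
    let f : minus K.coe {u} →g minus (prune α G).coe {v} :=
      { toFun := fun y => ⟨⟨y.1.1, hKP.1 y.1.2⟩, fun e => hu y.1 y.2 (congrArg Subtype.val e)⟩
        map_rel' := fun {a b} hab => hKP.2 hab }
    have hf : Function.Injective f := by
      intro a b hab
      exact Subtype.ext (Subtype.ext (congrArg (fun z => z.1.1) hab))
    let x' : {y : K.verts // y ∉ ({u} : Set K.verts)} :=
      ⟨⟨x, hxK⟩, fun e => hux (congrArg Subtype.val e).symm⟩
    have h1 := hK.2 u ((minus K.coe {u}).connectedComponentMk x')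
    refine h1.trans (Nat.succ_le_succ ?_)
    refine Set.ncard_le_ncard_of_injOn f ?_ hf.injOn (Set.toFinite _)
    intro y hy
    have hr : (minus K.coe {u}).Reachable y x' := SimpleGraph.ConnectedComponent.exact hy
    exact SimpleGraph.ConnectedComponent.sound (hr.map f)

theorem prune_eq_bot {V : Type*} [Finite V] (α : ℕ) (G : SimpleGraph V)
    (h : ¬ ∃ K : G.Subgraph, IsRobust α K.coe) : prune α G = ⊥ := by
  have : {K : G.Subgraph | IsRobust α K.coe} = ∅ :=
    Set.eq_empty_of_forall_notMem fun K hK => h ⟨K, hK⟩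
  rw [prune, this, sSup_empty]

/-! ### Graphs with a set of marked vertices, as words over a finite alphabet -/

/-- The data an algorithm writes down to describe a graph together with a set of vertices: the
number of vertices (the vertices are `0, …, numVerts - 1`), a list of edges, and a list of marked
vertices. -/
@[ext] structure MarkedGraph where
  numVerts : ℕ
  edges : List (ℕ × ℕ)
  marked : List ℕ
  edges_lt : ∀ e ∈ edges, e.1 < numVerts ∧ e.2 < numVerts
  edges_ne : ∀ e ∈ edges, e.1 ≠ e.2
  marked_lt : ∀ s ∈ marked, s < numVerts

namespace MarkedGraph

/-- The described graph. -/
def graph (A : MarkedGraph) : SimpleGraph (Fin A.numVerts) :=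
  SimpleGraph.fromRel fun u v => ((u : ℕ), (v : ℕ)) ∈ A.edges

/-- The described set of vertices. -/
def markedSet (A : MarkedGraph) : Finset (Fin A.numVerts) :=
  Finset.univ.filter fun v => (v : ℕ) ∈ A.marked

/-- The output alphabet. -/
inductive Symbol
  | one
  | comma
  | semicolon
  | bar

/-- The word `1^N | 1^u,1^v; … 1^u,1^v; | 1^s; … 1^s;` that describes the number `N` of vertices,
the edges `uv` and the marked vertices `s`. -/
def encode (A : MarkedGraph) : List Symbol :=
  List.replicate A.numVerts Symbol.one ++ [Symbol.bar] ++
    A.edges.flatMap (fun e => List.replicate e.1 Symbol.one ++ [Symbol.comma] ++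
      List.replicate e.2 Symbol.one ++ [Symbol.semicolon]) ++ [Symbol.bar] ++
    A.marked.flatMap (fun s => List.replicate s Symbol.one ++ [Symbol.semicolon])

theorem replicate_one_inj {a b : ℕ} {x y : Symbol} {l k : List Symbol} (hx : x ≠ Symbol.one)
    (hy : y ≠ Symbol.one)
    (h : List.replicate a Symbol.one ++ x :: l = List.replicate b Symbol.one ++ y :: k) :
    a = b ∧ x = y ∧ l = k := by
  induction a generalizing b with
  | zero =>
    cases b with
    | zero => simpa using h
    | succ b => simp [List.replicate_succ] at h; exact absurd h.1 hx
  | succ a ih =>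
    cases b with
    | zero => simp [List.replicate_succ] at h; exact absurd h.1.symm hy
    | succ b =>
      simp only [List.replicate_succ, List.cons_append, List.cons.injEq, true_and] at h
      obtain ⟨h1, h2⟩ := ih h
      exact ⟨by rw [h1], h2⟩

/-- The word determines the description. -/
theorem encode_injective : Function.Injective encode := by
  have hmark : ∀ l k : List ℕ,
      l.flatMap (fun s => List.replicate s Symbol.one ++ [Symbol.semicolon]) =
        k.flatMap (fun s => List.replicate s Symbol.one ++ [Symbol.semicolon]) → l = k := by
    intro l
    induction l with
    | nil => intro k h; cases k <;> simp_all
    | cons a l ih =>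
      intro k h
      cases k with
      | nil => simp at h
      | cons b k =>
        simp only [List.flatMap_cons, List.append_assoc, List.cons_append, List.nil_append] at h
        obtain ⟨h1, -, h2⟩ := replicate_one_inj (by simp) (by simp) h
        rw [h1, ih k h2]
  have hedge : ∀ (l k : List (ℕ × ℕ)) (p q : List Symbol),
      l.flatMap (fun e => List.replicate e.1 Symbol.one ++ [Symbol.comma] ++
        List.replicate e.2 Symbol.one ++ [Symbol.semicolon]) ++ Symbol.bar :: p =
      k.flatMap (fun e => List.replicate e.1 Symbol.one ++ [Symbol.comma] ++
        List.replicate e.2 Symbol.one ++ [Symbol.semicolon]) ++ Symbol.bar :: q →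
      l = k ∧ p = q := by
    intro l
    induction l with
    | nil =>
      intro k p q h
      cases k with
      | nil => simpa using h
      | cons b k =>
        simp only [List.flatMap_cons, List.flatMap_nil, List.append_assoc, List.cons_append,
          List.nil_append] at h
        have := replicate_one_inj (a := 0) (by simp) (by simp) h
        simp at this
    | cons a l ih =>
      intro k p q h
      cases k with
      | nil =>
        simp only [List.flatMap_cons, List.flatMap_nil, List.append_assoc, List.cons_append,
          List.nil_append] at h
        have := replicate_one_inj (b := 0) (by simp) (by simp) h
        simp at this
      | cons b k =>
        simp only [List.flatMap_cons, List.append_assoc, List.cons_append, List.nil_append] at h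
        obtain ⟨h1, -, h2⟩ := replicate_one_inj (by simp) (by simp) h
        obtain ⟨h3, -, h4⟩ := replicate_one_inj (by simp) (by simp) h2
        obtain ⟨h5, h6⟩ := ih k p q (by simpa using h4)
        exact ⟨by rw [Prod.ext h1 h3, h5], h6⟩
  intro A B h
  simp only [encode, List.append_assoc, List.cons_append, List.nil_append] at h
  obtain ⟨h1, -, h2⟩ := replicate_one_inj (by simp) (by simp) h
  obtain ⟨h3, h4⟩ := hedge _ _ _ _ (by simpa using h2)
  exact MarkedGraph.ext h1 h3 (hmark _ _ h4)

end MarkedGraph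

end ClauseGadget

open ClauseGadget

/-!
Deleting one vertex `v` of `H` leaves components; let `D` be a smallest one over all choices of `v`,
and let `c` be the vertex to which it is attached. Then `D ∪ {c}` is a smallest leaf-block of `H`:
it is biconnected and contains no further cut vertex, since otherwise a smaller component would
appear, and conversely every leaf-block contains such a component
(`IsFragment.isLeafBlock_of_minimal`, `IsFragment.lt_ncard_of_isLeafBlock`). So `|D| = α - 1` for
`α = slb H`, and `H` itself is `α`-robust.

Fix a vertex `p` of `D`. If `H - D` is equipped with two copies of `D` instead of one, the two
resulting copies of `H` share `H - D`. A *literal* is such a double copy in which the vertex `p` of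
the first copy of `D` is marked and the vertex `p` of the second one is identified with a port of
another copy of `H`, a *hub*. If a hitting set contains just one vertex of the literal and this is
the marked one, then it must contain the port as well; if it contains `c`, both copies of `D` become
harmless. A hub has three ports `x`, `y`, `z` and a hitting set with one vertex in each of the
packed copies can afford only one of them. The hubs are joined to a chain by *links*: a link hangs
on the port `z` of one hub and on the port `x` of the next, and forces one of the two to be hit.
Hence at most one marked vertex can be hit, and hitting the one in block `t` is possible: take
`z`, `y`, `x` in the hubs before, at and after block `t`.

Counting the copies gives the two packings. The union of copies is glued along single vertices in
the manner of a tree, so that tree decompositions of the parts of `H` combine (`HasDecomp.glue`).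
What remains after the deletion of a hitting set consists of proper parts of `H`, joined through
copies of `D \ {p}`, of size `α - 2`, that are attached by a single vertex. A robust subgraph avoids
these (`IsRobust.notMem_verts`), so the components of the pruned graph embed properly into `H`
(`IsRobust.component_isMinor`). Moreover `H` is not a minor, because a smallest model of the robust
graph `H` spans a robust subgraph (`IsMinor.exists_isModel_isRobust`).

The description of the gadget is periodic: up to the last block, the edges of a block are the
translates of a fixed finite list. An explicit stack machine that keeps the offset of the current
block in unary prints such lists in polynomial time (`Printer.nonempty_computable`).
-/

namespace ClauseGadget

open SimpleGraph

variable {V : Type*} {G : SimpleGraph V}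

/-! ### Connectivity inside a set of vertices -/

/-- `a` and `b` are joined by a walk of `G` that stays in `t`. -/
def JoinedIn (G : SimpleGraph V) (t : Set V) (a b : V) : Prop :=
  ∃ p : G.Walk a b, ∀ x ∈ p.support, x ∈ t

theorem JoinedIn.refl {t : Set V} {a : V} (h : a ∈ t) : JoinedIn G t a a :=
  ⟨Walk.nil, by simpa using h⟩

theorem JoinedIn.symm {t : Set V} {a b : V} (h : JoinedIn G t a b) : JoinedIn G t b a := by
  obtain ⟨p, hp⟩ := h
  exact ⟨p.reverse, by simpa using hp⟩

theorem JoinedIn.trans {t : Set V} {a b d : V} (h : JoinedIn G t a b) (h' : JoinedIn G t b d) :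
    JoinedIn G t a d := by
  obtain ⟨p, hp⟩ := h
  obtain ⟨q, hq⟩ := h'
  refine ⟨p.append q, fun x hx => ?_⟩
  rcases (Walk.mem_support_append_iff p q).1 hx with hx | hx
  exacts [hp x hx, hq x hx]

theorem JoinedIn.mono {t t' : Set V} (htt : t ⊆ t') {a b : V} (h : JoinedIn G t a b) :
    JoinedIn G t' a b := by
  obtain ⟨p, hp⟩ := h
  exact ⟨p, fun x hx => htt (hp x hx)⟩

theorem JoinedIn.step {t : Set V} {a b : V} (ha : a ∈ t) (hb : b ∈ t) (h : G.Adj a b) :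
    JoinedIn G t a b :=
  ⟨h.toWalk, by simp [ha, hb]⟩

theorem JoinedIn.map {W : Type*} {G' : SimpleGraph W} (f : G →g G') {t : Set V} {a b : V}
    (h : JoinedIn G t a b) : JoinedIn G' (f '' t) (f a) (f b) := by
  obtain ⟨p, hp⟩ := h
  refine ⟨p.map f, fun x hx => ?_⟩
  rw [Walk.support_map, List.mem_map] at hx
  obtain ⟨y, hy, rfl⟩ := hx
  exact ⟨y, hp y hy, rfl⟩

/-- A set that contains `a` and is closed under the edges of `G` inside `t` contains every vertex
joined to `a` in `t`. -/
theorem JoinedIn.mem_of_closed {t s : Set V} {a b : V} (h : JoinedIn G t a b) (ha : a ∈ s)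
    (hs : ∀ u ∈ s, ∀ w ∈ t, G.Adj u w → w ∈ s) : b ∈ s := by
  obtain ⟨p, hp⟩ := h
  induction p with
  | nil => exact ha
  | cons hadj p ih =>
    simp only [Walk.support_cons, List.mem_cons, forall_eq_or_imp] at hp
    exact ih (hs _ ha _ (hp.2 _ p.start_mem_support) hadj) hp.2

theorem joinedIn_iff {t : Set V} {a b : V} (ha : a ∈ t) (hb : b ∈ t) :
    JoinedIn G t a b ↔ (G.induce t).Reachable ⟨a, ha⟩ ⟨b, hb⟩ := by
  constructor
  · rintro ⟨p, hp⟩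
    exact ⟨p.induce t hp⟩
  · rintro ⟨p⟩
    refine ⟨p.map (Embedding.induce t).toHom, fun x hx => ?_⟩
    obtain ⟨y, -, rfl⟩ := List.mem_map.1
      ((congrArg (x ∈ ·) (Walk.support_map (Embedding.induce t).toHom p)).mp hx)
    exact y.2

theorem preconnected_induce_iff_joinedIn {t : Set V} :
    (G.induce t).Preconnected ↔ ∀ a ∈ t, ∀ b ∈ t, JoinedIn G t a b :=
  ⟨fun h _ ha _ hb => (joinedIn_iff ha hb).2 (h _ _),
    fun h a b => (joinedIn_iff a.2 b.2).1 (h _ a.2 _ b.2)⟩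

theorem connected_induce_iff_joinedIn {t : Set V} :
    (G.induce t).Connected ↔ t.Nonempty ∧ ∀ a ∈ t, ∀ b ∈ t, JoinedIn G t a b := by
  rw [connected_iff, preconnected_induce_iff_joinedIn, and_comm, Set.nonempty_coe_sort]

theorem connected_induce_of_center {t : Set V} {a : V} (ha : a ∈ t)
    (h : ∀ b ∈ t, JoinedIn G t b a) : (G.induce t).Connected :=
  connected_induce_iff_joinedIn.2 ⟨⟨a, ha⟩, fun b hb d hd => (h b hb).trans (h d hd).symm⟩

theorem mem_of_closed_of_preconnected (h : G.Preconnected) {s : Set V} {a : V} (ha : a ∈ s)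
    (hs : ∀ u ∈ s, ∀ w, G.Adj u w → w ∈ s) (b : V) : b ∈ s := by
  obtain ⟨p⟩ := h a b
  exact JoinedIn.mem_of_closed (t := Set.univ) ⟨p, fun _ _ => trivial⟩ ha
    fun u hu w _ => hs u hu w

/-! ### Fragments: the components left by the deletion of one vertex -/

/-- `D` is the vertex set of a connected component of `G - v`. -/
structure IsFragment (G : SimpleGraph V) (v : V) (D : Set V) : Prop where
  notMem : v ∉ D
  connected : (G.induce D).Connected
  closed : ∀ u ∈ D, ∀ w, G.Adj u w → w ∈ D ∨ w = v

theorem IsFragment.subset {v : V} {D t : Set V} (h : IsFragment G v D) {a : V} (ha : a ∈ D)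
    (hat : a ∈ t) (ht : ∀ u ∈ t, ∀ w, G.Adj u w → w ∈ D → w ∈ t) : D ⊆ t := by
  intro b hb
  exact ((connected_induce_iff_joinedIn.1 h.connected).2 a ha b hb).mem_of_closed hat
    fun u hu w hw huw => ht u hu w huw hw

theorem IsFragment.exists_adj {v : V} {D : Set V} (h : IsFragment G v D) (hG : G.Connected) :
    ∃ w ∈ D, G.Adj w v := by
  by_contra! hcon
  obtain ⟨a, ha⟩ := (connected_induce_iff_joinedIn.1 h.connected).1
  refine h.notMem (mem_of_closed_of_preconnected hG.preconnected ha (fun u hu w huw => ?_) v)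
  rcases h.closed u hu w huw with hw | rfl
  · exact hw
  · exact absurd huw (hcon u hu)

theorem isFragment_component (v : V) (d : (minus G {v}).ConnectedComponent) :
    IsFragment G v (Subtype.val '' d.supp) := by
  refine ⟨?_, ?_, ?_⟩
  · rintro ⟨x, -, hx⟩
    exact x.2 hx
  · have := d.connected_toSimpleGraph
    refine this.map (f := (⟨fun x => ⟨x.1.1, x.1, x.2, rfl⟩, fun h => h⟩ :
      d.toSimpleGraph →g G.induce (Subtype.val '' d.supp))) ?_
    rintro ⟨_, x, hx, rfl⟩
    exact ⟨⟨x, hx⟩, rfl⟩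
  · rintro _ ⟨x, hx, rfl⟩ w hw
    by_cases hwv : w = v
    · exact Or.inr hwv
    · exact Or.inl ⟨⟨w, hwv⟩, d.mem_supp_of_adj_mem_supp hx hw, rfl⟩

theorem exists_isFragment_mem {v a : V} (h : a ≠ v) :
    ∃ D, IsFragment G v D ∧ a ∈ D ∧
      ∀ b ∈ D, JoinedIn G {v}ᶜ a b := by
  refine ⟨_, isFragment_component v ((minus G {v}).connectedComponentMk ⟨a, h⟩),
    ⟨⟨a, h⟩, rfl, rfl⟩, ?_⟩
  rintro _ ⟨b, hb, rfl⟩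
  exact (joinedIn_iff (t := {v}ᶜ) h b.2).2 (ConnectedComponent.exact hb).symm

/-! ### Cut vertices and biconnectedness in terms of vertex sets -/

theorem isCutVertex_iff [Finite V] (hG : G.Connected) (v : V) :
    IsCutVertex G v ↔ ¬ ∀ a ≠ v, ∀ b ≠ v, JoinedIn G {v}ᶜ a b := by
  have h1 : Nat.card G.ConnectedComponent = 1 := by
    have := hG.nonempty
    have := hG.preconnected.subsingleton_connectedComponent
    exact Nat.card_of_subsingleton (G.connectedComponentMk (Classical.arbitrary V))
  have h2 : (minus G {v}).Preconnected ↔ ∀ a ≠ v, ∀ b ≠ v, JoinedIn G {v}ᶜ a b :=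
    preconnected_induce_iff_joinedIn (t := {v}ᶜ)
  rw [IsCutVertex, h1, ← h2, Finite.one_lt_card_iff_nontrivial, ← not_subsingleton_iff_nontrivial,
    not_iff_not]
  exact ⟨fun _ _ _ => ConnectedComponent.exact (Subsingleton.elim _ _),
    fun h => h.subsingleton_connectedComponent⟩

/-- The vertex set `s` induces a biconnected subgraph. -/
structure BiconnectedOn (G : SimpleGraph V) (s : Set V) : Prop where
  nonempty : s.Nonempty
  joined : ∀ a ∈ s, ∀ b ∈ s, JoinedIn G s a b
  joined_diff : ∀ v ∈ s, ∀ a ∈ s \ {v}, ∀ b ∈ s \ {v}, JoinedIn G (s \ {v}) a b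

theorem biconnectedOn_of_isBiconnected [Finite V] {K : G.Subgraph} (h : IsBiconnected K.coe) :
    BiconnectedOn G K.verts := by
  obtain ⟨hc, hcut⟩ := h
  refine ⟨?_, ?_, ?_⟩
  · obtain ⟨x⟩ := hc.nonempty
    exact ⟨x.1, x.2⟩
  · intro a ha b hb
    obtain ⟨p⟩ := hc.preconnected ⟨a, ha⟩ ⟨b, hb⟩
    have : JoinedIn K.coe Set.univ ⟨a, ha⟩ ⟨b, hb⟩ := ⟨p, fun _ _ => trivial⟩
    exact (this.map K.hom).mono (by simp)
  · intro v hv a ha b hb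
    have := not_not.1 ((isCutVertex_iff hc ⟨v, hv⟩).not.1 (hcut _)) ⟨a, ha.1⟩
      (fun e => ha.2 (congrArg Subtype.val e)) ⟨b, hb.1⟩ (fun e => hb.2 (congrArg Subtype.val e))
    refine (this.map K.hom).mono ?_
    rintro _ ⟨x, hx, rfl⟩
    exact ⟨x.2, fun e => hx (Subtype.ext e)⟩

theorem BiconnectedOn.isBiconnected [Finite V] {s : Set V} (h : BiconnectedOn G s) :
    IsBiconnected ((⊤ : G.Subgraph).induce s).coe := by
  -- walks of `G` inside `s` are walks of the induced subgraph
  have key : ∀ t : Set V, ∀ a b (ha : a ∈ s) (hb : b ∈ s), t ⊆ s → JoinedIn G t a b →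
      JoinedIn ((⊤ : G.Subgraph).induce s).coe (Subtype.val ⁻¹' t) ⟨a, ha⟩ ⟨b, hb⟩ := by
    rintro t a b ha hb hts ⟨p, hp⟩
    induction p with
    | nil => exact .refl (hp _ (by simp))
    | @cons u v w hadj p ih =>
      simp only [Walk.support_cons, List.mem_cons, forall_eq_or_imp] at hp
      have hv := hp.2 _ p.start_mem_support
      refine (JoinedIn.step (b := (⟨v, hts hv⟩ : ((⊤ : G.Subgraph).induce s).verts)) hp.1 hv ?_).trans (ih _ hb hp.2)
      simpa using ⟨ha, hts hv, hadj⟩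
  have hc : ((⊤ : G.Subgraph).induce s).coe.Connected := by
    rw [connected_iff]
    refine ⟨fun a b => ?_, ?_⟩
    · obtain ⟨p, -⟩ := key s a b a.2 b.2 subset_rfl (h.joined a a.2 b b.2)
      exact ⟨p⟩
    · obtain ⟨x, hx⟩ := h.nonempty
      exact ⟨⟨x, hx⟩⟩
  refine ⟨hc, fun v => ?_⟩
  rw [isCutVertex_iff hc, not_not]
  intro a ha b hb
  refine (key (s \ {v.1}) a b a.2 b.2 Set.sdiff_subset (h.joined_diff v v.2 a
    ⟨a.2, fun e => ha (Subtype.ext e)⟩ b ⟨b.2, fun e => hb (Subtype.ext e)⟩)).mono ?_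
  intro x hx e
  exact hx.2 (congrArg Subtype.val e)

theorem isBiconnectedComponent_iff [Finite V] {B : G.Subgraph} (h : IsBiconnectedComponent G B) :
    BiconnectedOn G B.verts ∧ ∀ s, BiconnectedOn G s → B.verts ⊆ s → s ⊆ B.verts := by
  refine ⟨biconnectedOn_of_isBiconnected h.1, fun s hs hBs => ?_⟩
  have : B ≤ (⊤ : G.Subgraph).induce s :=
    Subgraph.le_induce_top_verts.trans (Subgraph.induce_mono_right hBs)
  exact (h.2 hs.isBiconnected this).1

theorem isBiconnectedComponent_induce [Finite V] {s : Set V} (h : BiconnectedOn G s)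
    (hmax : ∀ t, BiconnectedOn G t → s ⊆ t → t ⊆ s) :
    IsBiconnectedComponent G ((⊤ : G.Subgraph).induce s) := by
  refine ⟨h.isBiconnected, fun K hK hle => ?_⟩
  exact Subgraph.le_induce_top_verts.trans
    (Subgraph.induce_mono_right (hmax _ (biconnectedOn_of_isBiconnected hK) hle.1))

/-- Adding an ear: a biconnected set together with a path between two of its vertices is again
biconnected. -/
theorem BiconnectedOn.union_path {s : Set V} (h : BiconnectedOn G s) {b u : V} (hb : b ∈ s)
    (hu : u ∈ s) (p : G.Walk b u) (hp : p.IsPath) :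
    BiconnectedOn G (s ∪ {x | x ∈ p.support}) := by
  classical
  -- after the deletion of `v` every remaining vertex of the path is joined to an end of the path
  have key : ∀ v, ∀ q ∈ p.support, q ≠ v → ∃ a ∈ s, a ≠ v ∧
      JoinedIn G ((s ∪ {x | x ∈ p.support}) \ {v}) q a := by
    intro v q hq hqv
    by_cases hv : v ∈ (p.takeUntil q hq).support
    · have hv' : v ∉ (p.dropUntil q hq).support := by
        intro hv'
        rw [← Walk.cons_tail_support] at hv'
        have := hp.support_nodup
        rw [← p.take_spec hq, Walk.support_append] at this
        rcases List.mem_cons.1 hv' with e | hv'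
        · exact hqv e.symm
        · exact (List.disjoint_of_nodup_append this) hv hv'
      refine ⟨u, hu, fun e => hv' (e ▸ Walk.end_mem_support _), p.dropUntil q hq, fun x hx =>
        ⟨Or.inr (p.support_dropUntil_subset_support hq hx), fun e => hv' (e ▸ hx)⟩⟩
    · refine ⟨b, hb, fun e => hv (e ▸ Walk.start_mem_support _), (p.takeUntil q hq).reverse,
        fun x hx => ?_⟩
      rw [Walk.support_reverse, List.mem_reverse] at hx
      exact ⟨Or.inr (p.support_takeUntil_subset_support hq hx), fun e => hv (e ▸ hx)⟩
  have hdiff : ∀ v, ∀ a ∈ s, a ≠ v → ∀ d ∈ s, d ≠ v → JoinedIn G (s \ {v}) a d := by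
    intro v a ha hav d hd hdv
    by_cases hv : v ∈ s
    · exact h.joined_diff v hv a ⟨ha, hav⟩ d ⟨hd, hdv⟩
    · rw [Set.sdiff_singleton_eq_self hv]
      exact h.joined a ha d hd
  have key' : ∀ v, ∀ q ∈ (s ∪ {x | x ∈ p.support}) \ {v}, ∃ a ∈ s, a ≠ v ∧
      JoinedIn G ((s ∪ {x | x ∈ p.support}) \ {v}) q a := by
    rintro v q ⟨hq | hq, hqv⟩
    · exact ⟨q, hq, hqv, .refl ⟨Or.inl hq, hqv⟩⟩
    · exact key v q hq hqv
  have hpre : ∀ v, ∀ q ∈ (s ∪ {x | x ∈ p.support}) \ {v}, ∀ r ∈ (s ∪ {x | x ∈ p.support}) \ {v},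
      JoinedIn G ((s ∪ {x | x ∈ p.support}) \ {v}) q r := by
    intro v q hq r hr
    obtain ⟨a, ha, hav, hqa⟩ := key' v q hq
    obtain ⟨d, hd, hdv, hrd⟩ := key' v r hr
    exact (hqa.trans ((hdiff v a ha hav d hd hdv).mono
      (Set.sdiff_subset_sdiff_left Set.subset_union_left))).trans hrd.symm
  refine ⟨h.nonempty.mono Set.subset_union_left, ?_, fun v _ => hpre v⟩
  have hpj : ∀ q ∈ p.support, JoinedIn G (s ∪ {x | x ∈ p.support}) q b := fun q hq =>
    ⟨(p.takeUntil q hq).reverse, fun x hx => by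
      rw [Walk.support_reverse, List.mem_reverse] at hx
      exact Or.inr (p.support_takeUntil_subset_support hq hx)⟩
  have hsj : ∀ q ∈ s ∪ {x | x ∈ p.support}, JoinedIn G (s ∪ {x | x ∈ p.support}) q b := by
    rintro q (hq | hq)
    · exact (h.joined q hq b hb).mono Set.subset_union_left
    · exact hpj q hq
  exact fun q hq r hr => (hsj q hq).trans (hsj r hr).symm

/-- A vertex of a biconnected component with a neighbour outside of the component is a cut
vertex: otherwise an ear could be added to the component. -/
theorem isCutVertex_of_adj_notMem [Finite V] (hG : G.Connected) {s : Set V}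
    (h : BiconnectedOn G s) (hmax : ∀ t, BiconnectedOn G t → s ⊆ t → t ⊆ s) {b b' w : V}
    (hb : b ∈ s) (hb' : b' ∈ s) (hne : b' ≠ b) (hw : w ∉ s) (hbw : G.Adj b w) :
    IsCutVertex G b := by
  classical
  rw [isCutVertex_iff hG]
  intro hcon
  obtain ⟨p, hp⟩ := hcon w hbw.ne' b' hne
  have hpath : (Walk.cons hbw p.bypass).IsPath := by
    rw [Walk.cons_isPath_iff]
    exact ⟨p.bypass_isPath, fun hmem => hp b (p.support_bypass_subset_support hmem) rfl⟩
  have := hmax _ (h.union_path hb hb' _ hpath) Set.subset_union_left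
  exact hw (this (Or.inr (by simp)))

theorem biconnectedOn_pair {b w : V} (h : G.Adj b w) : BiconnectedOn G {b, w} := by
  refine ⟨⟨b, by simp⟩, ?_, ?_⟩
  · have h1 : JoinedIn G {b, w} b w := .step (by simp) (by simp) h
    have h2 : ∀ a ∈ ({b, w} : Set V), JoinedIn G {b, w} a b := by
      rintro a (rfl | rfl)
      exacts [.refl (by simp), h1.symm]
    exact fun a ha d hd => (h2 a ha).trans (h2 d hd).symm
  · rintro v (rfl | rfl) a ⟨ha, hav⟩ d ⟨hd, hdv⟩
    · obtain rfl : a = w := by simpa [show a ≠ v from hav] using ha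
      obtain rfl : d = a := by simpa [show d ≠ v from hdv] using hd
      exact .refl ⟨hd, hdv⟩
    · obtain rfl : a = b := by simpa [show a ≠ v from hav] using ha
      obtain rfl : d = a := by simpa [show d ≠ v from hdv] using hd
      exact .refl ⟨hd, hdv⟩

/-! ### A smallest fragment together with its vertex of attachment is a smallest leaf-block -/

section MinimalFragment

variable {v : V} {D : Set V}

/-- If `D` is a smallest fragment, then no vertex `u` of `D` cuts off anything: every fragment at `u`
contains the vertex to which `D` is attached. -/
theorem IsFragment.mem_of_minimal [Finite V] (h : IsFragment G v D) (hG : G.Connected)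
    (hmin : ∀ v' D', IsFragment G v' D' → D.ncard ≤ D'.ncard) {u : V} (hu : u ∈ D) {D' : Set V}
    (h' : IsFragment G u D') : v ∈ D' := by
  by_contra hv
  -- a fragment at `u` that avoids `v` would be a proper subset of `D`
  obtain ⟨w, hw, hwu⟩ := h'.exists_adj hG
  have hwD : w ∈ D := (h.closed u hu w hwu.symm).resolve_right fun e => hv (e ▸ hw)
  have hsub : D' ⊆ D := h'.subset hw hwD fun a ha b hab hb =>
    (h.closed a ha b hab).resolve_right fun e => hv (e ▸ hb)
  have : D'.ncard < D.ncard :=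
    Set.ncard_lt_ncard ⟨hsub, fun hDD' => h'.notMem (hDD' hu)⟩ (Set.toFinite _)
  exact absurd (hmin u D' h') (by omega)

/-- A walk that starts in a fragment and leaves it passes through the vertex of attachment. -/
theorem IsFragment.joinedIn_attachment (h : IsFragment G v D) {u a : V} (ha : a ∈ insert v D)
    (hj : JoinedIn G {u}ᶜ a v) : JoinedIn G (insert v D \ {u}) a v := by
  obtain ⟨p, hp⟩ := hj
  induction p with
  | nil => exact .refl ⟨ha, hp _ (by simp)⟩
  | @cons a b v hadj p ih =>
    simp only [Walk.support_cons, List.mem_cons, forall_eq_or_imp] at hp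
    rcases ha with rfl | ha
    · exact .refl ⟨Or.inl rfl, hp.1⟩
    · have hb : b ∈ insert v D := (h.closed a ha b hadj).symm
      exact (JoinedIn.step (t := insert v D \ {u}) ⟨Or.inr ha, hp.1⟩ ⟨hb, hp.2 _ p.start_mem_support⟩ hadj).trans
        (ih h hb hp.2)

theorem IsFragment.biconnectedOn_of_minimal [Finite V] (h : IsFragment G v D) (hG : G.Connected)
    (hmin : ∀ v' D', IsFragment G v' D' → D.ncard ≤ D'.ncard) :
    BiconnectedOn G (insert v D) := by
  have hD := connected_induce_iff_joinedIn.1 h.connected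
  refine ⟨⟨v, by simp⟩, ?_, ?_⟩
  · obtain ⟨w, hw, hwv⟩ := h.exists_adj hG
    have hwv' : JoinedIn G (insert v D) w v := .step (Or.inr hw) (Or.inl rfl) hwv
    have : ∀ a ∈ insert v D, JoinedIn G (insert v D) a v := by
      rintro a (rfl | ha)
      · exact .refl (Or.inl rfl)
      · exact ((hD.2 a ha w hw).mono (Set.subset_insert _ _)).trans hwv'
    exact fun a ha b hb => (this a ha).trans (this b hb).symm
  · rintro u (rfl | hu)
    · rw [Set.insert_sdiff_self_of_notMem h.notMem]
      exact hD.2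
    · have hvu : v ≠ u := fun e => h.notMem (e ▸ hu)
      have : ∀ a ∈ insert v D \ {u}, JoinedIn G (insert v D \ {u}) a v := by
        rintro a ⟨ha, hau⟩
        obtain ⟨D', hD', haD', hj⟩ := exists_isFragment_mem (G := G) hau
        exact h.joinedIn_attachment ha (hj v (h.mem_of_minimal hG hmin hu hD'))
      exact fun a ha b hb => (this a ha).trans (this b hb).symm

theorem IsFragment.isLeafBlock_of_minimal [Finite V] (h : IsFragment G v D) (hG : G.Connected)
    (hmin : ∀ v' D', IsFragment G v' D' → D.ncard ≤ D'.ncard) :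
    IsLeafBlock G ((⊤ : G.Subgraph).induce (insert v D)) := by
  obtain ⟨d, hd⟩ := (connected_induce_iff_joinedIn.1 h.connected).1
  refine ⟨isBiconnectedComponent_induce (h.biconnectedOn_of_minimal hG hmin) ?_, ?_⟩
  · intro t ht hsub w hw
    by_contra hwD
    have hvt := hsub (Set.mem_insert _ _)
    refine hwD (Or.inr ((ht.joined_diff v hvt d ⟨hsub (Or.inr hd), fun e => h.notMem (e ▸ hd)⟩ w
      ⟨hw, fun e => hwD (Or.inl e)⟩).mem_of_closed hd fun a ha b hb hab => ?_))
    exact (h.closed a ha b hab).resolve_right hb.2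
  · refine (Set.ncard_le_ncard (t := {v}) ?_).trans (by simp)
    rintro u ⟨hu, hcut⟩
    rcases hu with rfl | hu
    · rfl
    · exfalso
      rw [isCutVertex_iff hG] at hcut
      refine hcut fun a ha b hb => ?_
      obtain ⟨D₁, hD₁, -, hj₁⟩ := exists_isFragment_mem (G := G) ha
      obtain ⟨D₂, hD₂, -, hj₂⟩ := exists_isFragment_mem (G := G) hb
      exact (hj₁ v (h.mem_of_minimal hG hmin hu hD₁)).trans
        (hj₂ v (h.mem_of_minimal hG hmin hu hD₂)).symm

/-- Every leaf-block contains a fragment and its vertex of attachment: a second vertex with a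
neighbour outside of the block would be a second cut vertex. -/
theorem IsFragment.lt_ncard_of_isLeafBlock [Finite V] (h : IsFragment G v D) (hG : G.Connected)
    (hmin : ∀ v' D', IsFragment G v' D' → D.ncard ≤ D'.ncard) {B : G.Subgraph}
    (hB : IsLeafBlock G B) : D.ncard < B.verts.ncard := by
  obtain ⟨hbi, hmax⟩ := isBiconnectedComponent_iff hB.1
  by_cases huniv : B.verts = Set.univ
  · rw [huniv]
    exact Set.ncard_lt_ncard ⟨Set.subset_univ _, fun hD => h.notMem (hD trivial)⟩ (Set.toFinite _)
  obtain ⟨b, hb, w, hw, hbw⟩ : ∃ b ∈ B.verts, ∃ w, w ∉ B.verts ∧ G.Adj b w := by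
    by_contra! hcon
    obtain ⟨a, ha⟩ := hbi.nonempty
    refine huniv (Set.eq_univ_of_forall (mem_of_closed_of_preconnected hG.preconnected ha
      fun u hu x hux => ?_))
    by_contra hx
    exact hcon u hu x hx hux
  obtain ⟨b', hb', hne⟩ : ∃ b' ∈ B.verts, b' ≠ b := by
    by_contra! hcon
    refine hw (hmax _ (biconnectedOn_pair hbw) (fun x hx => ?_) (by simp))
    simp [hcon x hx]
  obtain ⟨D', hD', hbD', -⟩ := exists_isFragment_mem (G := G) hne
  have hsub : D' ⊆ D' ∩ B.verts := by
    refine hD'.subset hbD' ⟨hbD', hb'⟩ fun u hu x hux hx => ⟨hx, ?_⟩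
    -- otherwise `b` and `u` are two cut vertices in `B`
    by_contra hxB
    have hub : u ≠ b := fun e => hD'.notMem (e ▸ hu.1)
    have h1 := isCutVertex_of_adj_notMem hG hbi hmax hb hb' hne hw hbw
    have h2 := isCutVertex_of_adj_notMem hG hbi hmax hu.2 hb hub.symm hxB hux
    exact hub ((Set.ncard_le_one (Set.toFinite _)).1 hB.2 _ ⟨hu.2, h2⟩ _ ⟨hb, h1⟩)
  calc D.ncard ≤ D'.ncard := hmin b D' hD'
    _ < B.verts.ncard :=
      Set.ncard_lt_ncard 
        ⟨fun x hx => (hsub hx).2, fun hBD => hD'.notMem (hBD hb)⟩ (Set.toFinite _)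

end MinimalFragment

/-- Some fragment of `H` together with its vertex of attachment has `slb H` vertices, and no
fragment is smaller. -/
theorem exists_isFragment_slb [Finite V] {H : SimpleGraph V} (hH : H.Connected)
    (hcard : 2 ≤ Nat.card V) :
    ∃ v D, IsFragment H v D ∧ D.ncard + 1 = slb H ∧
      ∀ v' D', IsFragment H v' D' → slb H ≤ D'.ncard + 1 := by
  obtain ⟨a, b, hab⟩ := (Finite.one_lt_card_iff_nontrivial.1 hcard).exists_pair_ne
  obtain ⟨D₀, hD₀, -⟩ := exists_isFragment_mem (G := H) hab
  let P : ℕ → Prop := fun k => ∃ v D, IsFragment H v D ∧ D.ncard = k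
  have hP : ∃ k, P k := ⟨_, b, D₀, hD₀, rfl⟩
  classical
  obtain ⟨v, D, hD, hDk⟩ := Nat.find_spec hP
  have hmin : ∀ v' D', IsFragment H v' D' → D.ncard ≤ D'.ncard := fun v' D' h' =>
    hDk ▸ Nat.find_min' hP ⟨v', D', h', rfl⟩
  have hlb := hD.isLeafBlock_of_minimal hH hmin
  have hsize : ((⊤ : H.Subgraph).induce (insert v D)).verts.ncard = D.ncard + 1 :=
    Set.ncard_insert_of_notMem hD.notMem (Set.toFinite _)
  have heq : slb H = D.ncard + 1 := by
    refine le_antisymm (Nat.sInf_le ⟨_, hlb, hsize⟩) ?_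
    refine le_csInf ⟨_, _, hlb, hsize⟩ ?_
    rintro k ⟨B, hB, rfl⟩
    exact hD.lt_ncard_of_isLeafBlock hH hmin hB
  exact ⟨v, D, hD, heq.symm, fun v' D' h' => heq ▸ Nat.succ_le_succ (hmin v' D' h')⟩

end ClauseGadget

namespace ClauseGadget

open SimpleGraph

/-! ### Robust subgraphs and minors -/

theorem mem_of_closed_of_reachable {W : Type*} {G : SimpleGraph W} {a b : W}
    (h : G.Reachable a b) {s : Set W} (ha : a ∈ s) (hs : ∀ u ∈ s, ∀ w, G.Adj u w → w ∈ s) :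
    b ∈ s := by
  obtain ⟨p⟩ := h
  exact JoinedIn.mem_of_closed (t := Set.univ) ⟨p, fun _ _ => trivial⟩ ha
    fun u hu w _ => hs u hu w

theorem isRobust_slb {V : Type*} [Finite V] {H : SimpleGraph V} (hH : H.Connected)
    (hcard : 2 ≤ Nat.card V) : IsRobust (slb H) H := by
  obtain ⟨v, D, hD, heq, hmin⟩ := exists_isFragment_slb hH hcard
  refine ⟨?_, fun u d => ?_⟩
  · rw [← heq, ← Set.ncard_univ]
    exact Set.ncard_lt_ncard ⟨Set.subset_univ _, fun h => hD.notMem (h trivial)⟩ (Set.toFinite _)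
  · refine (hmin u _ (isFragment_component u d)).trans_eq ?_
    rw [Set.ncard_image_of_injective _ Subtype.val_injective]

variable {V U : Type*} {H : SimpleGraph V} {F : SimpleGraph U} {α : ℕ}

theorem IsModel.exists_injective {φ : V → Set U} (hφ : IsModel H F φ) :
    ∃ r : V → U, (∀ x, r x ∈ φ x) ∧ Function.Injective r := by
  have hne : ∀ x, (φ x).Nonempty := fun x => (connected_induce_iff_joinedIn.1 (hφ.connected x)).1
  choose r hr using hne
  refine ⟨r, hr, fun x y hxy => ?_⟩
  by_contra hne
  exact Set.disjoint_left.1 (hφ.disjoint x y hne) (hr x) (hxy ▸ hr y)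

theorem JoinedIn.reachable_coe_induce {Z : Set U} {a b : U} (h : JoinedIn F Z a b) (ha : a ∈ Z)
    (hb : b ∈ Z) : ((⊤ : F.Subgraph).induce Z).coe.Reachable ⟨a, ha⟩ ⟨b, hb⟩ :=
  ((joinedIn_iff ha hb).1 h).map
    (⟨fun x => ⟨x.1, x.2⟩, fun {x y} hxy => ⟨x.2, y.2, hxy⟩⟩ :
      F.induce Z →g ((⊤ : F.Subgraph).induce Z).coe)

variable [Finite U]

/-- A robust subgraph avoids every small set of vertices with at most one neighbour outside. -/
theorem IsRobust.notMem_verts {K : F.Subgraph} (hK : IsRobust α K.coe) {Q : Set U}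
    (hQ : Q.ncard + 1 < α)
    (hout : ∀ u ∈ Q, ∀ u' ∈ Q, ∀ w ∉ Q, ∀ w' ∉ Q, F.Adj u w → F.Adj u' w' → w = w') {q : U}
    (hq : q ∈ Q) : q ∉ K.verts := by
  intro hqK
  obtain ⟨a, haq, ha⟩ : ∃ a : K.verts, a.1 ≠ q ∧
      ∀ u ∈ Q, ∀ w ∈ K.verts, w ∉ Q → F.Adj u w → w = a := by
    by_cases h : ∃ u ∈ Q, ∃ w ∈ K.verts, w ∉ Q ∧ F.Adj u w
    · obtain ⟨u, hu, w, hw, hwQ, huw⟩ := h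
      exact ⟨⟨w, hw⟩, fun (e : w = q) => hwQ (e ▸ hq),
        fun u' hu' w' _ hw'Q huw' => hout _ hu' _ hu _ hw'Q _ hwQ huw' huw⟩
    · have : 1 < Nat.card K.verts := lt_of_lt_of_le (by omega) hK.1
      have := Finite.one_lt_card_iff_nontrivial.1 this
      obtain ⟨a, ha⟩ := exists_ne (⟨q, hqK⟩ : K.verts)
      exact ⟨a, fun e => ha (Subtype.ext e),
        fun u hu w hw hwQ huw => absurd ⟨u, hu, w, hw, hwQ, huw⟩ h⟩
  let q' : {y : K.verts // y ∉ ({a} : Set K.verts)} :=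
    ⟨⟨q, hqK⟩, fun e => haq (congrArg Subtype.val e).symm⟩
  have h1 := hK.2 a ((minus K.coe {a}).connectedComponentMk q')
  have h2 : ((minus K.coe {a}).connectedComponentMk q').supp.ncard ≤ Q.ncard := by
    refine Set.ncard_le_ncard_of_injOn (fun y => y.1.1) (fun y hy => ?_) ?_ (Set.toFinite _)
    · refine mem_of_closed_of_reachable (s := {y | y.1.1 ∈ Q})
        (ConnectedComponent.exact hy).symm hq fun u hu w huw => ?_
      by_contra hw
      exact w.2 (Subtype.ext (ha u.1.1 hu w.1.1 w.1.2 hw (K.adj_sub huw)))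
    · intro y _ z _ hyz
      exact Subtype.ext (Subtype.ext hyz)
  omega

/-- In a model of a robust connected graph, a small set `D` that is attached to the rest of the
model by a single vertex `v` is superfluous. -/
theorem IsModel.diff [Finite V] {φ : V → Set U} (hφ : IsModel H F φ) (hH : H.Connected)
    (hrob : IsRobust α H) {D : Set U} {v : U} (hv : v ∉ D) (hD : D.ncard + 1 < α)
    (hout : ∀ u ∈ D, ∀ w, (∃ x, w ∈ φ x) → F.Adj u w → w ∈ D ∨ w = v) :
    IsModel H F (fun x => φ x \ D) := by
  have hconn := fun x => (connected_induce_iff_joinedIn.1 (hφ.connected x)).2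
  have hmeet : ∀ x, v ∉ φ x → (φ x ∩ D).Nonempty → φ x ⊆ D := by
    rintro x hvx ⟨a, hax, haD⟩ b hb
    refine (hconn x a hax b hb).mem_of_closed haD fun u hu w hw huw => ?_
    exact (hout u hu w ⟨x, hw⟩ huw).resolve_right fun e => hvx (e ▸ hw)
  -- a branch set inside `D` would give a component of `H`, or of `H` minus a vertex, that is too
  -- small
  have hstep : ∀ x, φ x ⊆ D → ∀ x', H.Adj x x' → v ∉ φ x' → φ x' ⊆ D := by
    intro x hx x' hxx' hvx'
    obtain ⟨u, hu, u', hu', huu'⟩ := hφ.edge x x' hxx'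
    refine hmeet x' hvx' ⟨u', hu', ?_⟩
    exact (hout u (hx hu) u' ⟨x', hu'⟩ huu').resolve_right fun e => hvx' (e ▸ hu')
  obtain ⟨r, hr, hrinj⟩ := hφ.exists_injective
  have hT : {x | φ x ⊆ D}.ncard ≤ D.ncard :=
    Set.ncard_le_ncard_of_injOn r (fun x hx => hx (hr x)) hrinj.injOn (Set.toFinite _)
  have hnot : ∀ x, ¬ φ x ⊆ D := by
    intro x hx
    by_cases hy : ∃ y, v ∈ φ y
    · obtain ⟨y, hy⟩ := hy
      have hxy : x ∉ ({y} : Set V) := by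
        rintro rfl
        exact hv (hx hy)
      have h1 := hrob.2 y ((minus H {y}).connectedComponentMk ⟨x, hxy⟩)
      have h2 : ((minus H {y}).connectedComponentMk ⟨x, hxy⟩).supp.ncard ≤
          {x | φ x ⊆ D}.ncard := by
        refine Set.ncard_le_ncard_of_injOn Subtype.val (fun z hz => ?_)
          Subtype.val_injective.injOn (Set.toFinite _)
        refine mem_of_closed_of_reachable (s := {z | φ z.1 ⊆ D})
          (ConnectedComponent.exact hz).symm hx fun a ha b hab => hstep a.1 ha b.1 hab fun hb => ?_
        exact Set.disjoint_left.1 (hφ.disjoint b.1 y b.2) hb hy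
      omega
    · have : {x | φ x ⊆ D} = Set.univ := Set.eq_univ_of_forall
        (mem_of_closed_of_preconnected hH.preconnected hx
          fun a ha b hab => hstep a ha b hab fun hb => hy ⟨b, hb⟩)
      rw [this, Set.ncard_univ] at hT
      have := hrob.1
      omega
  have hvD : ∀ x, (φ x ∩ D).Nonempty → v ∈ φ x := fun x hx => by
    by_contra hvx
    exact hnot x (hmeet x hvx hx)
  refine ⟨fun x => ?_, ?_, fun x y hxy => ?_⟩
  · by_cases hx : (φ x ∩ D).Nonempty
    · have hvx := hvD x hx
      refine connected_induce_of_center (a := v) ⟨hvx, hv⟩ ?_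
      rintro b ⟨hb, hbD⟩
      obtain ⟨p, hp⟩ := hconn x b hb v hvx
      clear hx hvx
      induction p with
      | nil => exact .refl ⟨hb, hbD⟩
      | @cons a b v hadj p ih =>
        simp only [Walk.support_cons, List.mem_cons, forall_eq_or_imp] at hp
        by_cases hav : a = v
        · exact hav ▸ .refl ⟨hb, hbD⟩
        · have hbx := hp.2 _ p.start_mem_support
          have hb' : b ∉ D := fun h =>
            (hout b h a ⟨x, hb⟩ hadj.symm).elim hbD hav
          exact (JoinedIn.step (t := φ x \ D) ⟨hb, hbD⟩ ⟨hbx, hb'⟩ hadj).trans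
            (ih hv hout hmeet hstep hvD hbx hb' hp.2)
    · rw [sdiff_eq_left.2 (Set.disjoint_iff_inter_eq_empty.2 (Set.not_nonempty_iff_eq_empty.1 hx))]
      exact hφ.connected x
  · -- both ends of an edge that realises an edge of `H` lie outside of `D`
    have hend : ∀ x y u u', H.Adj x y → u ∈ φ x → u' ∈ φ y → F.Adj u u' → u ∉ D := by
      intro x y u u' hxy hu hu' huu' huD
      have hvx := hvD x ⟨u, hu, huD⟩
      have hvy : v ∉ φ y := Set.disjoint_left.1 (hφ.disjoint x y hxy.ne) hvx
      exact hvy (hvD y ⟨u', hu', (hout u huD u' ⟨y, hu'⟩ huu').resolve_right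
        fun e => hvy (e ▸ hu')⟩)
    intro x y hxy
    obtain ⟨u, hu, u', hu', huu'⟩ := hφ.edge x y hxy
    exact ⟨u, ⟨hu, hend x y u u' hxy hu hu' huu'⟩, u',
      ⟨hu', hend y x u' u hxy.symm hu' hu huu'.symm⟩, huu'⟩
  · exact (hφ.disjoint x y hxy).mono Set.sdiff_subset Set.sdiff_subset

/-- A smallest model of a robust connected graph spans a robust subgraph. -/
theorem IsMinor.exists_isModel_isRobust [Finite V] (h : IsMinor H F) (hH : H.Connected)
    (hrob : IsRobust α H) :
    ∃ φ, IsModel H F φ ∧ IsRobust α ((⊤ : F.Subgraph).induce (⋃ x, φ x)).coe := by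
  let P : ℕ → Prop := fun k => ∃ φ, IsModel H F φ ∧ (⋃ x, φ x).ncard = k
  have hP : ∃ k, P k := by
    obtain ⟨φ, hφ⟩ := h
    exact ⟨_, φ, hφ, rfl⟩
  classical
  obtain ⟨φ, hφ, hk⟩ := Nat.find_spec hP
  have hmin : ∀ φ', IsModel H F φ' → (⋃ x, φ x).ncard ≤ (⋃ x, φ' x).ncard := fun φ' h' =>
    hk ▸ Nat.find_min' hP ⟨φ', h', rfl⟩
  refine ⟨φ, hφ, ?_, fun v d => ?_⟩
  · obtain ⟨r, hr, hrinj⟩ := hφ.exists_injective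
    refine hrob.1.trans (Nat.card_le_card_of_injective
      (fun x => (⟨r x, Set.mem_iUnion.2 ⟨x, hr x⟩⟩ : ((⊤ : F.Subgraph).induce (⋃ x, φ x)).verts))
      fun x y hxy => hrinj (congrArg Subtype.val hxy))
  · by_contra! hlt
    let D : Set U := (fun y => y.1.1) '' d.supp
    have hDcard : D.ncard = d.supp.ncard :=
      Set.ncard_image_of_injective _ fun y z hyz => Subtype.ext (Subtype.ext hyz)
    have hdiff := hφ.diff hH hrob (D := D) (v := v.1) ?_ (by omega) ?_
    · obtain ⟨y, hy⟩ := d.nonempty_supp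
      have hy1 : y.1.1 ∈ ⋃ x, φ x := y.1.2
      have := hmin _ hdiff
      have hlt' : (⋃ x, φ x \ D).ncard < (⋃ x, φ x).ncard := by
        refine Set.ncard_lt_ncard ⟨Set.iUnion_mono fun x => Set.sdiff_subset, fun hsub => ?_⟩
          (Set.toFinite _)
        obtain ⟨x, hx⟩ := Set.mem_iUnion.1 (hsub hy1)
        exact hx.2 ⟨y, hy, rfl⟩
      omega
    · rintro ⟨y, -, hyv⟩
      exact y.2 (Subtype.ext hyv)
    · rintro _ ⟨y, hy, rfl⟩ w hw hyw
      by_cases hwv : w = v.1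
      · exact Or.inr hwv
      · have hwZ : w ∈ ⋃ x, φ x := Set.mem_iUnion.2 hw
        refine Or.inl ⟨⟨⟨w, hwZ⟩, fun e => hwv (congrArg Subtype.val e)⟩,
          d.mem_supp_of_adj_mem_supp hy ?_, rfl⟩
        exact ⟨y.1.2, hwZ, hyw⟩

/-- If the components of all robust subgraphs of `F` have fewer vertices than `H`, then `H` is not
a minor of `F`. -/
theorem not_isMinor_of_forall_isRobust [Finite V] (hH : H.Connected) (hrob : IsRobust α H)
    (h : ∀ K : F.Subgraph, IsRobust α K.coe → ∀ d : K.coe.ConnectedComponent,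
      d.supp.ncard < Nat.card V) : ¬ IsMinor H F := by
  intro hmin
  obtain ⟨φ, hφ, hK⟩ := hmin.exists_isModel_isRobust hH hrob
  obtain ⟨r, hr, hrinj⟩ := hφ.exists_injective
  obtain ⟨x₀⟩ := hH.nonempty
  have hZ : ∀ x, φ x ⊆ ⋃ x, φ x := Set.subset_iUnion φ
  have hconn := fun x => (connected_induce_iff_joinedIn.1 (hφ.connected x)).2
  have hreach : ∀ x, JoinedIn F (⋃ x, φ x) (r x₀) (r x) := by
    refine mem_of_closed_of_preconnected hH.preconnected
      (JoinedIn.refl (hZ _ (hr x₀))) fun x hx y hxy => ?_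
    obtain ⟨u, hu, u', hu', huu'⟩ := hφ.edge x y hxy
    exact (JoinedIn.trans hx ((hconn x _ (hr x) _ hu).mono (hZ x))).trans
      ((JoinedIn.step (hZ x hu) (hZ y hu') huu').trans
        ((hconn y _ hu' _ (hr y)).mono (hZ y)))
  have hlt := h _ hK (connectedComponentMk _ ⟨r x₀, hZ _ (hr x₀)⟩)
  refine hlt.not_ge ?_
  rw [← Set.ncard_univ]
  refine Set.ncard_le_ncard_of_injOn
    (fun x => (⟨r x, hZ _ (hr x)⟩ : ((⊤ : F.Subgraph).induce (⋃ x, φ x)).verts)) (fun x _ => ?_)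
    (fun x _ y _ hxy => hrinj (congrArg Subtype.val hxy)) (Set.toFinite _)
  exact ConnectedComponent.sound ((hreach x).reachable_coe_induce _ _).symm

/-- Suppose that, apart from small sets `Q k` with at most one neighbour outside, the vertices of
`F` fall into classes that are pairwise non-adjacent and embed properly into `H`. Then the
components of every robust subgraph of `F` embed properly into `H`. -/
theorem IsRobust.component_isMinor [Finite V] {ι κ : Type*} (core : U → ι) (f : U → V)
    (Q : κ → Set U) (hQ : ∀ k, (Q k).ncard + 1 < α)
    (hout : ∀ k, ∀ u ∈ Q k, ∀ u' ∈ Q k, ∀ w ∉ Q k, ∀ w' ∉ Q k,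
      F.Adj u w → F.Adj u' w' → w = w')
    (hadj : ∀ u w, (∀ k, u ∉ Q k) → (∀ k, w ∉ Q k) → F.Adj u w →
      core u = core w ∧ H.Adj (f u) (f w))
    (hinj : ∀ u w, core u = core w → f u = f w → u = w)
    (hmiss : ∀ u, (∀ k, u ∉ Q k) →
      ∃ x, ∀ w, (∀ k, w ∉ Q k) → core w = core u → f w ≠ x)
    {K : F.Subgraph} (hK : IsRobust α K.coe) (d : K.coe.ConnectedComponent) :
    IsMinor (K.coe.induce d.supp) H ∧ d.supp.ncard < Nat.card V := by
  have hKQ : ∀ u ∈ K.verts, ∀ k, u ∉ Q k := fun u hu k huQ =>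
    hK.notMem_verts (hQ k) (hout k) huQ hu
  obtain ⟨a, ha⟩ := d.nonempty_supp
  have hcore : ∀ y ∈ d.supp, core y.1 = core a.1 := fun y hy =>
    mem_of_closed_of_reachable (s := {y : K.verts | core y.1 = core a.1})
      (ConnectedComponent.exact (ha.trans hy.symm)) rfl fun u hu w huw =>
        ((hadj _ _ (hKQ _ u.2) (hKQ _ w.2) (K.adj_sub huw)).1.symm.trans hu)
  have hinj' : ∀ y ∈ d.supp, ∀ z ∈ d.supp, f y.1 = f z.1 → y = z := fun y hy z hz hyz =>
    Subtype.ext (hinj _ _ ((hcore y hy).trans (hcore z hz).symm) hyz)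
  constructor
  · refine ⟨fun y => {f y.1.1}, fun y => ?_, fun y z hyz => ?_, fun y z hyz => ?_⟩
    · have := connected_induce_of_center (G := H) (t := {f y.1.1}) (a := f y.1.1) rfl
        fun b hb => hb ▸ .refl rfl
      exact this
    · exact ⟨_, rfl, _, rfl, (hadj _ _ (hKQ _ y.1.2) (hKQ _ z.1.2) (K.adj_sub hyz)).2⟩
    · rw [Set.disjoint_singleton]
      exact fun e => hyz (Subtype.ext (hinj' _ y.2 _ z.2 e))
  · obtain ⟨x, hx⟩ := hmiss a.1 (hKQ _ a.2)
    rw [← Set.ncard_univ]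
    refine lt_of_le_of_lt (b := ({x}ᶜ : Set V).ncard) ?_ ?_
    · exact Set.ncard_le_ncard_of_injOn (fun y => f y.1)
        (fun y hy => hx _ (hKQ _ y.2) (hcore y hy)) (fun y hy z hz => hinj' y hy z hz)
        (Set.toFinite _)
    · exact Set.ncard_lt_ncard ⟨Set.subset_univ _, fun h => h (Set.mem_univ x) rfl⟩
        (Set.toFinite _)

/-- The components of the pruned graph inherit what is known of the components of the robust
subgraphs. -/
theorem isCompMinor_prune
    (h : ∀ K : F.Subgraph, IsRobust α K.coe → IsCompMinor K.coe H) :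
    IsCompMinor (prune α F).coe H := by
  by_cases hex : ∃ K : F.Subgraph, IsRobust α K.coe
  · exact h _ (prune_isGreatest α F hex).1
  · rw [prune_eq_bot α F hex]
    intro d
    obtain ⟨x, -⟩ := d.exists_rep
    exact absurd x.2 id

end ClauseGadget

namespace ClauseGadget

open SimpleGraph

/-! ### Gluing tree decompositions -/

section Sum

variable {ι₁ ι₂ : Type*} {T₁ : SimpleGraph ι₁} {T₂ : SimpleGraph ι₂}

theorem isAcyclic_sum (h₁ : T₁.IsAcyclic) (h₂ : T₂.IsAcyclic) : (T₁ ⊕g T₂).IsAcyclic := by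
  rw [isAcyclic_iff_forall_adj_isBridge] at h₁ h₂ ⊢
  rintro (u | u) (v | v) huv
  · have huv' : T₁.Adj u v := huv
    refine fun hr => h₁ huv' ?_
    have := mem_of_closed_of_reachable
      (s := Sum.inl '' {w | (T₁.deleteEdges {s(u, v)}).Reachable u w}) hr ⟨u, .rfl, rfl⟩ ?_
    · obtain ⟨w, hw, e⟩ := this
      exact Sum.inl_injective e ▸ hw
    · rintro _ ⟨w, hw, rfl⟩ (x | x) hx
      · refine ⟨x, Reachable.trans hw (Adj.reachable ?_), rfl⟩
        simpa [deleteEdges_adj] using hx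
      · simp [deleteEdges_adj] at hx
  · simp at huv
  · simp at huv
  · have huv' : T₂.Adj u v := huv
    refine fun hr => h₂ huv' ?_
    have := mem_of_closed_of_reachable
      (s := Sum.inr '' {w | (T₂.deleteEdges {s(u, v)}).Reachable u w}) hr ⟨u, .rfl, rfl⟩ ?_
    · obtain ⟨w, hw, e⟩ := this
      exact Sum.inr_injective e ▸ hw
    · rintro _ ⟨w, hw, rfl⟩ (x | x) hx
      · simp [deleteEdges_adj] at hx
      · refine ⟨x, Reachable.trans hw (Adj.reachable ?_), rfl⟩
        simpa [deleteEdges_adj] using hx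

theorem isTree_sum_sup_edge (h₁ : T₁.IsTree) (h₂ : T₂.IsTree) (i₁ : ι₁) (i₂ : ι₂) :
    ((T₁ ⊕g T₂) ⊔ edge (Sum.inl i₁) (Sum.inr i₂)).IsTree :=
  ⟨h₁.connected.sum_sup_edge h₂.connected,
    (isAcyclic_sum h₁.isAcyclic h₂.isAcyclic).sup_edge_of_not_reachable
      (not_reachable_sum_inl_inr _ _)⟩

end Sum

variable {V W : Type*}

/-- `G`, all of whose edges lie in the vertex set `Z`, has a tree decomposition of width at most
`k` on the vertex set `Z`. The ambient type `W` of vertices may be infinite. -/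
def HasDecomp (k : ℕ) (G : SimpleGraph W) (Z : Set W) : Prop :=
  ∃ (ι : Type) (_ : Finite ι) (T : SimpleGraph ι) (bag : ι → Finset W), T.IsTree ∧
    (∀ i, ∀ v ∈ bag i, v ∈ Z) ∧ (∀ v ∈ Z, ∃ i, v ∈ bag i) ∧
    (∀ u v, G.Adj u v → ∃ i, u ∈ bag i ∧ v ∈ bag i) ∧
    (∀ v ∈ Z, (T.induce {i | v ∈ bag i}).Connected) ∧ ∀ i, (bag i).card ≤ k + 1

theorem hasDecomp_treewidth [Finite V] (H : SimpleGraph V) :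
    HasDecomp (treewidth H) H Set.univ := by
  have hne : {k | ∃ (m : ℕ) (T : SimpleGraph (Fin m)) (bag : Fin m → Finset V),
      IsTreeDecomposition H T bag ∧ ∀ i, (bag i).card ≤ k + 1}.Nonempty := by
    have := Fintype.ofFinite V
    refine ⟨Fintype.card V, 1, ⊥, fun _ => Finset.univ, ⟨.of_subsingleton, by simp, by simp,
      fun v => ?_⟩, fun _ => Nat.le_succ _⟩
    exact connected_induce_of_center (a := 0) (by simp)
      fun b _ => Subsingleton.elim (0 : Fin 1) b ▸ .refl (by simp)
  obtain ⟨m, T, bag, hT, hcard⟩ := Nat.sInf_mem hne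
  exact ⟨Fin m, inferInstance, T, bag, hT.isTree, fun _ _ _ => trivial, fun v _ => hT.vertex v,
    hT.edge, fun v _ => hT.connected v, hcard⟩

/-- A tree decomposition of `H` restricts to one of the image of a part `L` of `H`. -/
theorem HasDecomp.image {k : ℕ} {H : SimpleGraph V} (h : HasDecomp k H Set.univ) (f : V → W)
    {L : Set V} (hf : Set.InjOn f L) {G : SimpleGraph W}
    (hG : ∀ a b, G.Adj a b → ∃ u ∈ L, ∃ v ∈ L, H.Adj u v ∧ f u = a ∧ f v = b) :
    HasDecomp k G (f '' L) := by
  classical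
  obtain ⟨ι, hι, T, bag, hT, -, hv, he, hc, hk⟩ := h
  have hmem : ∀ u ∈ L, ∀ i, f u ∈ ((bag i).filter (· ∈ L)).image f ↔ u ∈ bag i := by
    intro u hu i
    simp only [Finset.mem_image, Finset.mem_filter]
    constructor
    · rintro ⟨u', ⟨hu', hu'L⟩, e⟩
      exact hf hu'L hu e ▸ hu'
    · exact fun h => ⟨u, ⟨h, hu⟩, rfl⟩
  refine ⟨ι, hι, T, fun i => ((bag i).filter (· ∈ L)).image f, hT, ?_, ?_, ?_, ?_, ?_⟩
  · intro i v hv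
    obtain ⟨u, hu, rfl⟩ := Finset.mem_image.1 hv
    exact ⟨u, (Finset.mem_filter.1 hu).2, rfl⟩
  · rintro _ ⟨u, hu, rfl⟩
    obtain ⟨i, hi⟩ := hv u trivial
    exact ⟨i, (hmem u hu i).2 hi⟩
  · intro a b hab
    obtain ⟨u, hu, v, hv, huv, rfl, rfl⟩ := hG a b hab
    obtain ⟨i, hi, hi'⟩ := he u v huv
    exact ⟨i, (hmem u hu i).2 hi, (hmem v hv i).2 hi'⟩
  · rintro _ ⟨u, hu, rfl⟩
    have : {i | f u ∈ ((bag i).filter (· ∈ L)).image f} = {i | u ∈ bag i} := Set.ext (hmem u hu)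
    rw [this]
    exact hc u trivial
  · exact fun i => Finset.card_image_le.trans ((Finset.card_filter_le _ _).trans (hk i))

/-- Two tree decompositions with at most one common vertex `a` can be joined by an edge between
two nodes whose bags contain `a`. -/
theorem HasDecomp.glue {k : ℕ} {G₁ G₂ : SimpleGraph W} {Z₁ Z₂ : Set W} (h₁ : HasDecomp k G₁ Z₁)
    (h₂ : HasDecomp k G₂ Z₂) (a : W) (ha : ∀ w ∈ Z₁, w ∈ Z₂ → w = a) :
    HasDecomp k (G₁ ⊔ G₂) (Z₁ ∪ Z₂) := by
  obtain ⟨ι₁, _, T₁, bag₁, hT₁, hZ₁, hv₁, he₁, hc₁, hk₁⟩ := h₁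
  obtain ⟨ι₂, _, T₂, bag₂, hT₂, hZ₂, hv₂, he₂, hc₂, hk₂⟩ := h₂
  obtain ⟨i₁, i₂, hi⟩ : ∃ i₁ i₂, a ∈ Z₁ → a ∈ Z₂ → a ∈ bag₁ i₁ ∧ a ∈ bag₂ i₂ := by
    by_cases h : a ∈ Z₁ ∧ a ∈ Z₂
    · obtain ⟨i₁, h₁⟩ := hv₁ a h.1
      obtain ⟨i₂, h₂⟩ := hv₂ a h.2
      exact ⟨i₁, i₂, fun _ _ => ⟨h₁, h₂⟩⟩
    · obtain ⟨i₁⟩ := hT₁.connected.nonempty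
      obtain ⟨i₂⟩ := hT₂.connected.nonempty
      exact ⟨i₁, i₂, fun h₁ h₂ => absurd ⟨h₁, h₂⟩ h⟩
  let T := (T₁ ⊕g T₂) ⊔ edge (Sum.inl i₁) (Sum.inr i₂)
  let f₁ : T₁ →g T := (Hom.ofLE le_sup_left).comp (Embedding.sumInl (G := T₁) (H := T₂)).toHom
  let f₂ : T₂ →g T := (Hom.ofLE le_sup_left).comp (Embedding.sumInr (G := T₁) (H := T₂)).toHom
  have hedge : T.Adj (.inl i₁) (.inr i₂) := Or.inr (by simp [edge_adj])
  refine ⟨ι₁ ⊕ ι₂, inferInstance, T, Sum.elim bag₁ bag₂, isTree_sum_sup_edge hT₁ hT₂ i₁ i₂,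
    ?_, ?_, ?_, ?_, ?_⟩
  · rintro (i | i) v hv
    exacts [Or.inl (hZ₁ i v hv), Or.inr (hZ₂ i v hv)]
  · rintro v (hv | hv)
    · obtain ⟨i, hi⟩ := hv₁ v hv
      exact ⟨.inl i, hi⟩
    · obtain ⟨i, hi⟩ := hv₂ v hv
      exact ⟨.inr i, hi⟩
  · rintro u v (huv | huv)
    · obtain ⟨i, hi⟩ := he₁ u v huv
      exact ⟨.inl i, hi⟩
    · obtain ⟨i, hi⟩ := he₂ u v huv
      exact ⟨.inr i, hi⟩
  · intro v hv
    rw [connected_induce_iff_joinedIn]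
    have hj₁ : ∀ i j, v ∈ bag₁ i → v ∈ bag₁ j →
        JoinedIn T {i | v ∈ Sum.elim bag₁ bag₂ i} (.inl i) (.inl j) := by
      intro i j hi hj
      have hvZ := hZ₁ i v hi
      refine (((connected_induce_iff_joinedIn.1 (hc₁ v hvZ)).2 i hi j hj).map f₁).mono ?_
      rintro _ ⟨x, hx, rfl⟩
      exact hx
    have hj₂ : ∀ i j, v ∈ bag₂ i → v ∈ bag₂ j →
        JoinedIn T {i | v ∈ Sum.elim bag₁ bag₂ i} (.inr i) (.inr j) := by
      intro i j hi hj
      have hvZ := hZ₂ i v hi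
      refine (((connected_induce_iff_joinedIn.1 (hc₂ v hvZ)).2 i hi j hj).map f₂).mono ?_
      rintro _ ⟨x, hx, rfl⟩
      exact hx
    have hj : ∀ i j, v ∈ bag₁ i → v ∈ bag₂ j →
        JoinedIn T {i | v ∈ Sum.elim bag₁ bag₂ i} (.inl i) (.inr j) := by
      intro i j hi' hj'
      have hva := ha v (hZ₁ i v hi') (hZ₂ j v hj')
      have hia := hi (hva ▸ hZ₁ i v hi') (hva ▸ hZ₂ j v hj')
      rw [← hva] at hia
      exact (hj₁ i i₁ hi' hia.1).trans
        ((JoinedIn.step (t := {i | v ∈ Sum.elim bag₁ bag₂ i}) hia.1 hia.2 hedge).trans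
          (hj₂ i₂ j hia.2 hj'))
    refine ⟨?_, ?_⟩
    · rcases hv with hv | hv
      · obtain ⟨i, hi⟩ := hv₁ v hv
        exact ⟨.inl i, hi⟩
      · obtain ⟨i, hi⟩ := hv₂ v hv
        exact ⟨.inr i, hi⟩
    · rintro (i | i) hi (j | j) hj'
      exacts [hj₁ i j hi hj', hj i j hi hj', (hj j i hj' hi).symm, hj₂ i j hi hj']
  · rintro (i | i)
    exacts [hk₁ i, hk₂ i]

theorem HasDecomp.mono {k : ℕ} {G G' : SimpleGraph W} {Z Z' : Set W} (h : HasDecomp k G Z)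
    (hG : ∀ u v, G'.Adj u v → G.Adj u v) (hZ : Z = Z') : HasDecomp k G' Z' := by
  subst hZ
  obtain ⟨ι, hι, T, bag, hT, hbZ, hv, he, hc, hk⟩ := h
  exact ⟨ι, hι, T, bag, hT, hbZ, hv, fun u v huv => he u v (hG u v huv), hc, hk⟩

theorem HasDecomp.treewidth_le [Finite V] {k : ℕ} {G : SimpleGraph W} {Z : Set W}
    (h : HasDecomp k G Z) {G' : SimpleGraph V} (f : V → W) (hf : Function.Injective f)
    (hfZ : ∀ v, f v ∈ Z) (hG : ∀ u v, G'.Adj u v → G.Adj (f u) (f v)) : treewidth G' ≤ k := by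
  classical
  have := Fintype.ofFinite V
  obtain ⟨ι, hι, T, bag, hT, -, hv, he, hc, hk⟩ := h
  let e := Finite.equivFin ι
  refine Nat.sInf_le ⟨Nat.card ι, T.comap e.symm,
    fun i => Finset.univ.filter fun v => f v ∈ bag (e.symm i), ⟨?_, ?_, ?_, ?_⟩, ?_⟩
  · exact (Iso.comap e.symm T).isTree_iff.2 hT
  · intro v
    obtain ⟨i, hi⟩ := hv _ (hfZ v)
    exact ⟨e i, by simpa using hi⟩
  · intro u v huv
    obtain ⟨i, hi⟩ := he _ _ (hG u v huv)
    exact ⟨e i, by simpa using hi⟩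
  · intro v
    obtain ⟨⟨i, hi⟩, hj⟩ := connected_induce_iff_joinedIn.1 (hc _ (hfZ v))
    refine connected_induce_iff_joinedIn.2 ⟨⟨e i, by simpa using hi⟩, fun a ha b hb => ?_⟩
    have hj' := (hj (e.symm a) (by simpa using ha) (e.symm b) (by simpa using hb)).map
      (Iso.comap e.symm T).symm.toHom
    have ha' : (Iso.comap e.symm T).symm.toHom (e.symm a) = a := e.apply_symm_apply a
    have hb' : (Iso.comap e.symm T).symm.toHom (e.symm b) = b := e.apply_symm_apply b
    rw [ha', hb'] at hj'
    refine hj'.mono ?_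
    rintro _ ⟨x, hx, rfl⟩
    have : e.symm ((Iso.comap e.symm T).symm.toHom x) = x := e.symm_apply_apply x
    simpa [this] using hx
  · intro i
    refine le_trans ?_ (hk (e.symm i))
    exact Finset.card_le_card_of_injOn f (fun v hv => by simpa using hv) hf.injOn

end ClauseGadget

namespace ClauseGadget

open SimpleGraph

/-! ### The gadget -/

/-- The parts of a block of the gadget. -/
inductive Slot
  | lit
  | litAlt
  | hub
  | link
  | linkLeft
  | linkRight

instance : Finite Slot :=
  Finite.of_surjective (![.lit, .litAlt, .hub, .link, .linkLeft, .linkRight] : Fin 6 → Slot)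
    fun s => match s with
      | .lit => ⟨0, rfl⟩
      | .litAlt => ⟨1, rfl⟩
      | .hub => ⟨2, rfl⟩
      | .link => ⟨3, rfl⟩
      | .linkLeft => ⟨4, rfl⟩
      | .linkRight => ⟨5, rfl⟩

/-- A vertex of the gadget: the number of its block, its slot in the block, and the vertex of `H`
that it stands for. -/
abbrev Label (V : Type*) := ℕ × Slot × V

/-- The choices in `H` on which the gadget depends: a set `D` of `α - 1` vertices all of whose
outside neighbours are `c`, a vertex `p` of `D`, and three distinct vertices `x`, `y`, `z`, the
ports of a hub. -/
structure Frame {V : Type*} (H : SimpleGraph V) (α : ℕ) where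
  (c p x y z : V)
  D : Set V
  c_notMem : c ∉ D
  p_mem : p ∈ D
  closed : ∀ u ∈ D, ∀ w, H.Adj u w → w ∈ D ∨ w = c
  ncard_D : D.ncard + 1 = α
  x_ne_y : x ≠ y
  y_ne_z : y ≠ z
  x_ne_z : x ≠ z

namespace Frame

variable {V : Type*} {H : SimpleGraph V} {α : ℕ} (g : Frame H α)

theorem c_ne_p : g.c ≠ g.p := fun e => g.c_notMem (e ▸ g.p_mem)

open scoped Classical in
/-- The copies of `H` of which the gadget is the union; there is one for each slot of each block.
* `lit` contains the marked vertex (its copy of `p`), `litAlt` shares `H - D` with it and meets the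
  hub of the block in the port `y`;
* `hub` is a copy of `H` on its own;
* `link` and `linkLeft` share `H - D`, and `linkLeft` meets the hub of the block in the port `z`;
  `linkRight` meets the next hub in the port `x`, and its copy of `c` is the copy of `p` in
  `link`. -/
noncomputable def copy (i : ℕ) (s : Slot) (v : V) : Label V :=
  match s with
  | .lit => (i, .lit, v)
  | .litAlt => if v = g.p then (i, .hub, g.y) else
      if v ∈ g.D then (i, .litAlt, v) else (i, .lit, v)
  | .hub => (i, .hub, v)
  | .link => if v = g.p then (i, .linkRight, g.c) else (i, .link, v)
  | .linkLeft => if v = g.p then (i, .hub, g.z) else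
      if v ∈ g.D then (i, .linkLeft, v) else (i, .link, v)
  | .linkRight => if v = g.p then (i + 1, .hub, g.x) else (i, .linkRight, v)

/-- The labels in use. -/
def Valid (a : Label V) : Prop :=
  match a.2.1 with
  | .lit => True
  | .litAlt => a.2.2 ∈ g.D ∧ a.2.2 ≠ g.p
  | .hub => True
  | .link => a.2.2 ≠ g.p
  | .linkLeft => a.2.2 ∈ g.D ∧ a.2.2 ≠ g.p
  | .linkRight => a.2.2 ≠ g.p

/-- The copies that occur in the gadget with `n` blocks: the last block has no links. -/
def Active (n i : ℕ) (s : Slot) : Prop :=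
  match s with
  | .lit | .litAlt | .hub => i < n
  | .link | .linkLeft | .linkRight => i + 1 < n

theorem copy_injective (i : ℕ) (s : Slot) : Function.Injective (g.copy i s) := by
  intro u v
  have := g.c_ne_p
  cases s <;> simp only [copy] <;> (try split_ifs) <;> simp_all

theorem valid_copy (i : ℕ) (s : Slot) (v : V) : g.Valid (g.copy i s v) := by
  have := g.c_ne_p
  cases s <;> simp only [copy] <;> (try split_ifs) <;> simp_all [Valid]

theorem copy_fst_lt {n i : ℕ} {s : Slot} (h : Active n i s) (v : V) : (g.copy i s v).1 < n := by
  cases s <;> simp only [copy, Active] at * <;> (try split_ifs) <;> simp_all <;> omega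

/-- The gadget with `n` blocks. -/
def graph (n : ℕ) : SimpleGraph (Label V) where
  Adj a b := ∃ i s, Active n i s ∧ ∃ u v, H.Adj u v ∧ g.copy i s u = a ∧ g.copy i s v = b
  symm := ⟨by
    rintro a b ⟨i, s, h, u, v, huv, hu, hv⟩
    exact ⟨i, s, h, v, u, huv.symm, hv, hu⟩⟩
  loopless := ⟨by
    rintro a ⟨i, s, h, u, v, huv, hu, hv⟩
    exact huv.ne (g.copy_injective i s (hu.trans hv.symm))⟩

/-- The pairs of vertices of the gadget of which a hitting set must contain one: the two outside
neighbours of the copy of `D \ {p}` in a slot. The values for `lit` and `hub` play no role. -/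
def anchors (i : ℕ) (s : Slot) : Label V × Label V :=
  match s with
  | .lit | .hub => ((i, .lit, g.c), (i, .lit, g.c))
  | .litAlt => ((i, .lit, g.c), (i, .hub, g.y))
  | .link => ((i, .link, g.c), (i, .linkRight, g.c))
  | .linkLeft => ((i, .link, g.c), (i, .hub, g.z))
  | .linkRight => ((i, .linkRight, g.c), (i + 1, .hub, g.x))

/-- The slots whose copies of `D \ {p}` get pruned. -/
def IsSide (s : Slot) : Prop :=
  match s with
  | .lit | .hub => False
  | .litAlt | .link | .linkLeft | .linkRight => True

/-- The copy of `D \ {p}` in a slot. -/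
def side (i : ℕ) (s : Slot) : Set (Label V) :=
  {a | a.1 = i ∧ a.2.1 = s ∧ IsSide s ∧ a.2.2 ∈ g.D ∧ a.2.2 ≠ g.p}

theorem adj_side {n i : ℕ} {s : Slot} {a b : Label V} (ha : a ∈ g.side i s)
    (hab : (g.graph n).Adj a b) :
    b ∈ g.side i s ∨ Active n i s ∧ (b = (g.anchors i s).1 ∨ b = (g.anchors i s).2) := by
  obtain ⟨j, t, hact, u, v, huv, rfl, rfl⟩ := hab
  have h1 := g.closed u
  have h2 := g.c_ne_p
  have h3 := g.c_notMem
  have h4 := fun h => h1 h v huv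
  obtain ⟨rfl, rfl, hs, hD, hp⟩ := ha
  cases t <;> simp only [copy] at * <;> (try split_ifs at *) <;>
    simp_all [side, anchors, IsSide, Active]

theorem adj_lit {n i : ℕ} {v : V} (hv : v ∈ g.D) {b : Label V}
    (hb : (g.graph n).Adj (i, .lit, v) b) :
    (∃ w ∈ g.D, b = (i, .lit, w)) ∨ b = (i, .lit, g.c) := by
  obtain ⟨j, t, hact, u, w, huv, h, rfl⟩ := hb
  have h1 := fun h => g.closed u h w huv
  cases t <;> simp only [copy] at * <;> (try split_ifs at *) <;> simp_all

/-- An edge of the gadget joins two vertices of the same slot, or has an end in a side, or joins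
the two anchors of a side. -/
theorem adj_cases {n : ℕ} {a b : Label V} (hab : (g.graph n).Adj a b) :
    (a.1 = b.1 ∧ a.2.1 = b.2.1 ∧ H.Adj a.2.2 b.2.2) ∨ (∃ i s, a ∈ g.side i s) ∨
      (∃ i s, b ∈ g.side i s) ∨ ∃ i s, Active n i s ∧ IsSide s ∧
        (a = (g.anchors i s).1 ∧ b = (g.anchors i s).2 ∨
          a = (g.anchors i s).2 ∧ b = (g.anchors i s).1) := by
  obtain ⟨i, s, hact, u, v, huv, rfl, rfl⟩ := hab
  have hu := fun h => g.closed u h v huv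
  have hv := fun h => g.closed v h u huv.symm
  have h2 := g.c_ne_p
  have h3 := g.c_notMem
  have h4 := huv.ne
  have h5 := g.p_mem
  by_cases hs : IsSide s
  · by_cases h : (g.copy i s u ∈ g.side i s ∨ g.copy i s v ∈ g.side i s)
    · rcases h with h | h
      exacts [Or.inr (Or.inl ⟨i, s, h⟩), Or.inr (Or.inr (Or.inl ⟨i, s, h⟩))]
    · by_cases h' : ((g.copy i s u).1 = (g.copy i s v).1 ∧
        (g.copy i s u).2.1 = (g.copy i s v).2.1 ∧ H.Adj (g.copy i s u).2.2 (g.copy i s v).2.2)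
      · exact Or.inl h'
      · refine Or.inr (Or.inr (Or.inr ⟨i, s, hact, hs, ?_⟩))
        cases s <;> simp only [copy] at * <;> (try split_ifs at *) <;>
          simp_all [side, anchors, IsSide]
  · left
    cases s <;> simp_all [IsSide, copy]

end Frame

end ClauseGadget

namespace ClauseGadget

open SimpleGraph

/-! ### The treewidth of the gadget -/

namespace Frame

variable {V : Type*} {H : SimpleGraph V} {α : ℕ} (g : Frame H α)

/-- The part of `H` that is glued on for a slot: as `litAlt` and `linkLeft` share `H - D` with `lit`
and `link`, only their copy of the leaf-block `D ∪ {c}` is new. -/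
def part (s : Slot) : Set V :=
  match s with
  | .litAlt | .linkLeft => insert g.c g.D
  | .lit | .hub | .link | .linkRight => Set.univ

/-- The image of `part s` in the gadget. -/
def piece (i : ℕ) (s : Slot) : Set (Label V) :=
  {a | a.1 = i ∧ a.2.1 = s ∧ g.Valid a ∨
    IsSide s ∧ (a = (g.anchors i s).1 ∨ a = (g.anchors i s).2)}

theorem image_part (i : ℕ) (s : Slot) : g.copy i s '' g.part s = g.piece i s := by
  have h1 := g.c_ne_p
  have h2 := g.c_notMem
  have h3 := g.p_mem
  ext a
  constructor
  · rintro ⟨v, hv, rfl⟩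
    cases s <;> simp only [copy, part] at * <;> (try split_ifs) <;>
      simp_all [piece, Valid, anchors, IsSide]
  · rintro (⟨rfl, rfl, hv⟩ | ⟨hs, rfl | rfl⟩)
    · obtain ⟨i, s, v⟩ := a
      refine ⟨v, ?_⟩
      cases s <;> simp_all [part, copy, Valid]
    · refine ⟨g.c, ?_⟩
      cases s <;> simp_all [part, copy, anchors, IsSide]
    · refine ⟨g.p, ?_⟩
      cases s <;> simp_all [part, copy, anchors, IsSide]

/-- The edges of a piece. -/
def pieceGraph (i : ℕ) (s : Slot) : SimpleGraph (Label V) where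
  Adj a b := ∃ u ∈ g.part s, ∃ v ∈ g.part s, H.Adj u v ∧ g.copy i s u = a ∧ g.copy i s v = b
  symm := ⟨by
    rintro a b ⟨u, hu, v, hv, huv, hua, hvb⟩
    exact ⟨v, hv, u, hu, huv.symm, hvb, hua⟩⟩
  loopless := ⟨by
    rintro a ⟨u, hu, v, hv, huv, hua, hvb⟩
    exact huv.ne (g.copy_injective i s (hua.trans hvb.symm))⟩

/-- The union of the pieces of the first `n` blocks. -/
def pieces : ℕ → SimpleGraph (Label V)
  | 0 => ⊥
  | i + 1 => pieces i ⊔ g.pieceGraph i .hub ⊔ g.pieceGraph i .litAlt ⊔ g.pieceGraph i .lit ⊔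
      g.pieceGraph i .linkLeft ⊔ g.pieceGraph i .link ⊔ g.pieceGraph i .linkRight

theorem pieceGraph_le (i n : ℕ) (s : Slot) (h : i < n) : g.pieceGraph i s ≤ g.pieces n := by
  induction n with
  | zero => omega
  | succ n ih =>
    intro a b hab
    simp only [pieces, sup_adj]
    by_cases hi : i = n
    · subst hi
      cases s <;> simp [hab]
    · simp [ih (by omega) hab]

theorem graph_le_pieces (n : ℕ) : g.graph n ≤ g.pieces n := by
  rintro a b ⟨i, s, hact, u, v, huv, rfl, rfl⟩
  have hi : i < n := by
    cases s <;> simp only [Active] at hact <;> omega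
  by_cases h : u ∈ g.part s ∧ v ∈ g.part s
  · exact g.pieceGraph_le i n s hi ⟨u, h.1, v, h.2, huv, rfl, rfl⟩
  · have hu := fun h => g.closed u h v huv
    have hv := fun h => g.closed v h u huv.symm
    have h3 := g.p_mem
    have hD : u ∉ g.D ∧ v ∉ g.D := by
      cases s <;> simp only [part, Set.mem_insert_iff, Set.mem_univ, not_true_eq_false, and_self]
        at h <;> grind
    have hp : u ≠ g.p ∧ v ≠ g.p := ⟨fun e => hD.1 (e ▸ h3), fun e => hD.2 (e ▸ h3)⟩
    cases s
    case litAlt =>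
      refine g.pieceGraph_le i n .lit hi ⟨u, trivial, v, trivial, huv, ?_, ?_⟩ <;>
        simp_all [copy]
    case linkLeft =>
      refine g.pieceGraph_le i n .link hi ⟨u, trivial, v, trivial, huv, ?_, ?_⟩ <;>
        simp_all [copy]
    all_goals exact absurd ⟨trivial, trivial⟩ h

/-- The gadget arises by gluing copies of parts of `H`, one after the other, along single
vertices. -/
theorem hasDecomp_pieces [Finite V] (n : ℕ) :
    HasDecomp (treewidth H) (g.pieces n)
      ({a | g.Valid a ∧ a.1 < n} ∪ {(n, .hub, g.x)}) := by
  have hH := hasDecomp_treewidth H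
  induction n with
  | zero =>
    refine (hH.image (fun _ => ((0, .hub, g.x) : Label V)) (L := {g.x}) (G := ⊥)
      (Set.injOn_singleton _ _) (fun _ _ h => h.elim)).mono (fun _ _ h => h) ?_
    simp
  | succ n ih =>
    have hpiece : ∀ s, HasDecomp (treewidth H) (g.pieceGraph n s) (g.piece n s) := fun s =>
      g.image_part n s ▸ hH.image _ (g.copy_injective n s).injOn fun _ _ h => h
    have h1 := g.c_ne_p
    have h2 := g.p_mem
    refine ((((((ih.glue (hpiece .hub) (n, .hub, g.x) ?_).glue
      (hpiece .litAlt) (n, .hub, g.y) ?_).glue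
      (hpiece .lit) (n, .lit, g.c) ?_).glue
      (hpiece .linkLeft) (n, .hub, g.z) ?_).glue
      (hpiece .link) (n, .link, g.c) ?_).glue
      (hpiece .linkRight) (n, .linkRight, g.c) ?_).mono (fun _ _ h => h) ?_
    all_goals simp only [piece, anchors, IsSide, Set.mem_union, Set.mem_ofPred_eq,
      Set.mem_singleton_iff, true_and, false_and, or_false]
    · grind
    · grind
    · grind
    · grind
    · grind
    · grind
    · ext ⟨j, s, v⟩
      simp only [Set.mem_union, Set.mem_ofPred_eq, Set.mem_singleton_iff]
      cases s <;> simp only [Valid, Prod.mk.injEq, reduceCtorEq] <;> grind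

end Frame

end ClauseGadget

namespace ClauseGadget

open SimpleGraph

/-! ### Packings and hitting sets of the gadget -/

theorem hasPacking_of_card {V W ι : Type*} [Fintype ι] {H : SimpleGraph V} {G : SimpleGraph W}
    {k : ℕ} (hk : Fintype.card ι = k) (f : ι → Copy H G)
    (hf : ∀ i j, i ≠ j → ∀ u v, f i u ≠ f j v) : HasPacking H G k := by
  let e := Fintype.equivFinOfCardEq hk
  refine ⟨fun i => f (e.symm i), fun i j hij => Set.disjoint_left.2 ?_⟩
  rintro _ ⟨u, rfl⟩ ⟨v, hv⟩
  exact hf _ _ (fun h => hij (e.symm.injective h)) u v hv.symm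

namespace Frame

variable {V W : Type*} {H : SimpleGraph V} {α : ℕ} {g : Frame H α} {n : ℕ} {G : SimpleGraph W}
  {lab : W → Label V}

/-- `lab` labels the vertices of `G` in such a way that `G` is the gadget with `n` blocks on all
valid labels of these blocks. The links of the last block are isolated vertices. -/
structure Realizes (g : Frame H α) (n : ℕ) (G : SimpleGraph W) (lab : W → Label V) : Prop where
  injective : Function.Injective lab
  range : ∀ a, (∃ w, lab w = a) ↔ g.Valid a ∧ a.1 < n
  adj : ∀ u v, G.Adj u v ↔ (g.graph n).Adj (lab u) (lab v)

theorem Realizes.treewidth_le [Finite V] [Finite W] (r : g.Realizes n G lab) :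
    treewidth G ≤ treewidth H :=
  (g.hasDecomp_pieces n).treewidth_le lab r.injective (fun w => Or.inl ((r.range _).1 ⟨w, rfl⟩))
    fun u v huv => g.graph_le_pieces n ((r.adj u v).1 huv)

theorem Realizes.exists_copy (r : g.Realizes n G lab) {i : ℕ} {s : Slot} (h : Active n i s) :
    ∃ f : Copy H G, ∀ v, lab (f v) = g.copy i s v := by
  choose f hf using fun v => (r.range (g.copy i s v)).2 ⟨g.valid_copy i s v, g.copy_fst_lt h v⟩
  refine ⟨⟨⟨f, fun {u v} huv => (r.adj _ _).2 ?_⟩, fun u v huv => ?_⟩, hf⟩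
  · exact ⟨i, s, h, u, v, huv, (hf u).symm, (hf v).symm⟩
  · exact g.copy_injective i s ((hf u).symm.trans ((congrArg lab huv).trans (hf v)))

/-- The copies in the slots `lit`, `hub` and `link` are pairwise disjoint. -/
theorem Realizes.hasPacking (r : g.Realizes n G lab) (hn : 1 ≤ n) :
    HasPacking H G (3 * n - 1) := by
  let idx : Fin n ⊕ Fin n ⊕ Fin (n - 1) → ℕ × Slot :=
    Sum.elim (fun i => (i, .lit)) (Sum.elim (fun i => (i, .hub)) fun i => (i, .link))
  have hact : ∀ k, Active n (idx k).1 (idx k).2 := by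
    rintro (i | i | i) <;> simp only [idx, Sum.elim_inl, Sum.elim_inr, Active] <;> omega
  choose f hf using fun k => r.exists_copy (hact k)
  refine hasPacking_of_card (by simp; omega) f fun k l hkl u v huv => ?_
  have h := congrArg lab huv
  rw [hf, hf] at h
  rcases k with k | k | k <;> rcases l with l | l | l <;>
    simp only [idx, Sum.elim_inl, Sum.elim_inr, copy] at h <;> (try split_ifs at h) <;>
    simp_all [Fin.ext_iff]

/-- The copies in the slots `litAlt`, `linkLeft` and `linkRight` are pairwise disjoint and contain
no marked vertex. -/
theorem Realizes.hasPacking_minus (r : g.Realizes n G lab) (hn : 1 ≤ n) {S : Set W}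
    (hS : ∀ w ∈ S, ∃ i, lab w = (i, .lit, g.p)) : HasPacking H (minus G S) (3 * n - 2) := by
  let idx : Fin n ⊕ Fin (n - 1) ⊕ Fin (n - 1) → ℕ × Slot :=
    Sum.elim (fun i => (i, .litAlt))
      (Sum.elim (fun i => (i, .linkLeft)) fun i => (i, .linkRight))
  have hact : ∀ k, Active n (idx k).1 (idx k).2 := by
    rintro (i | i | i) <;> simp only [idx, Sum.elim_inl, Sum.elim_inr, Active] <;> omega
  choose f hf using fun k => r.exists_copy (hact k)
  have hfS : ∀ k v, f k v ∉ S := by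
    intro k v hv
    obtain ⟨i, hi⟩ := hS _ hv
    rw [hf] at hi
    rcases k with k | k | k <;> simp only [idx, Sum.elim_inl, Sum.elim_inr, copy] at hi <;>
      split_ifs at hi <;> simp_all
  refine hasPacking_of_card (by simp; omega)
    (fun k => (⟨⟨fun v => ⟨f k v, hfS k v⟩, fun {u v} huv => (f k).toHom.map_adj huv⟩,
      fun u v huv => (f k).injective' (congrArg Subtype.val huv)⟩ : Copy H (minus G S)))
    fun k l hkl u v huv => ?_
  have h := congrArg lab (congrArg Subtype.val huv)
  change lab (f k u) = lab (f l v) at h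
  rw [hf, hf] at h
  have h1 := g.x_ne_y
  have h2 := g.y_ne_z
  have h3 := g.x_ne_z
  rcases k with k | k | k <;> rcases l with l | l | l <;>
    simp only [idx, Sum.elim_inl, Sum.elim_inr, copy] at h <;> split_ifs at h <;>
    simp_all [Fin.ext_iff]

/-- The hitting set of the gadget that contains the marked vertex of block `t`, as a family indexed
by the copies in the slots `lit`, `hub` and `link`. Hubs before `t` are hit in `z`, so that the links
after them are hit in `linkRight`; hubs after `t` are hit in `x`, so that the links before them are
hit in `link`. -/
noncomputable def hit (g : Frame H α) (n t : ℕ) : Fin n ⊕ Fin n ⊕ Fin (n - 1) → Label V :=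
  Sum.elim (fun i => (i, .lit, if (i : ℕ) = t then g.p else g.c))
    (Sum.elim (fun i => (i, .hub, if (i : ℕ) < t then g.z else if (i : ℕ) = t then g.y else g.x))
      fun i => (i, if (i : ℕ) < t then .linkRight else .link, g.c))

theorem hit_injective (n t : ℕ) : Function.Injective (g.hit n t) := by
  rintro (i | i | i) (j | j | j) h <;> simp only [hit, Sum.elim_inl, Sum.elim_inr] at h <;>
    (try split_ifs at h) <;> simp_all [Fin.ext_iff]

theorem valid_hit (n t : ℕ) (k) : g.Valid (g.hit n t k) ∧ (g.hit n t k).1 < n := by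
  have := g.c_ne_p
  rcases k with k | k | k <;> simp only [hit, Sum.elim_inl, Sum.elim_inr, Valid]
  · simp
  · simp
  · refine ⟨?_, by omega⟩
    split_ifs <;> simp_all

/-- One of the two anchors of each side is hit. -/
theorem exists_hit_anchor {t i : ℕ} {s : Slot} (hs : IsSide s) (hact : Active n i s) :
    ∃ k, g.hit n t k = (g.anchors i s).1 ∨ g.hit n t k = (g.anchors i s).2 := by
  have hlit : ∀ i, i < n → i ≠ t → ∃ k, g.hit n t k = (i, .lit, g.c) := fun i hi h =>
    ⟨.inl ⟨i, hi⟩, by simp [hit, h]⟩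
  have hhub : ∀ i, i < n → ∃ k, g.hit n t k =
      (i, .hub, if i < t then g.z else if i = t then g.y else g.x) := fun i hi =>
    ⟨.inr (.inl ⟨i, hi⟩), rfl⟩
  have hlink : ∀ i, i + 1 < n → ∃ k, g.hit n t k =
      (i, if i < t then .linkRight else .link, g.c) := fun i hi =>
    ⟨.inr (.inr ⟨i, by omega⟩), rfl⟩
  cases s <;> simp only [IsSide, Active] at hs hact <;> simp only [anchors]
  · by_cases h : i = t
    · obtain ⟨k, hk⟩ := hhub i hact
      exact ⟨k, Or.inr (by simp [hk, h])⟩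
    · obtain ⟨k, hk⟩ := hlit i hact h
      exact ⟨k, Or.inl hk⟩
  · obtain ⟨k, hk⟩ := hlink i hact
    refine ⟨k, ?_⟩
    by_cases h : i < t <;> simp [hk, h]
  · by_cases h : i < t
    · obtain ⟨k, hk⟩ := hhub i (by omega)
      exact ⟨k, Or.inr (by simp [hk, h])⟩
    · obtain ⟨k, hk⟩ := hlink i hact
      exact ⟨k, Or.inl (by simp [hk, h])⟩
  · by_cases h : i < t
    · obtain ⟨k, hk⟩ := hlink i hact
      exact ⟨k, Or.inl (by simp [hk, h])⟩
    · obtain ⟨k, hk⟩ := hhub (i + 1) hact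
      refine ⟨k, Or.inr ?_⟩
      rw [hk, if_neg (by omega), if_neg (by omega)]

theorem ncard_side_lt [Finite V] (hlab : Function.Injective lab) (i : ℕ) (s : Slot) :
    (lab ⁻¹' g.side i s).ncard + 1 < α := by
  have h : (lab ⁻¹' g.side i s).ncard ≤ (g.D \ {g.p}).ncard := by
    refine Set.ncard_le_ncard_of_injOn (fun w => (lab w).2.2) (fun w hw => hw.2.2.2) ?_
      (Set.toFinite _)
    intro u hu w hw huw
    exact hlab (Prod.ext (hu.1.trans hw.1.symm) (Prod.ext (hu.2.1.trans hw.2.1.symm) huw))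
  have h1 := Set.ncard_sdiff_singleton_add_one g.p_mem (Set.toFinite _)
  have h2 := g.ncard_D
  omega

/-- After the deletion of a hitting set, the gadget falls apart: the sides get pruned, and what
remains of each slot is a proper part of `H`. -/
theorem Realizes.component_isMinor [Finite V] [Finite W] (r : g.Realizes n G lab) {t : ℕ}
    {X : Set W} (hX : ∀ w ∉ X, ∀ k, lab w ≠ g.hit n t k) {K : (minus G X).Subgraph}
    (hK : IsRobust α K.coe) (d : K.coe.ConnectedComponent) :
    IsMinor (K.coe.induce d.supp) H ∧ d.supp.ncard < Nat.card V := by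
  have hlab : Function.Injective fun u : {w : W // w ∉ X} => lab u :=
    r.injective.comp Subtype.val_injective
  have hadj : ∀ u w : {w : W // w ∉ X}, (minus G X).Adj u w → (g.graph n).Adj (lab u) (lab w) :=
    fun u w huw => (r.adj u w).1 huw
  refine hK.component_isMinor (ι := ℕ × Slot) (κ := ℕ × Slot)
    (fun u : {w : W // w ∉ X} => ((lab u).1, (lab u).2.1)) (fun u => (lab u).2.2)
    (fun k => (fun u : {w : W // w ∉ X} => lab u.1) ⁻¹' g.side k.1 k.2) (fun k => ncard_side_lt hlab k.1 k.2)
    ?_ ?_ ?_ ?_ d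
  · rintro ⟨i, s⟩ u hu u' hu' w hw w' hw' huw huw'
    obtain ⟨hact, h⟩ := (g.adj_side hu (hadj _ _ huw)).resolve_left hw
    obtain ⟨-, h'⟩ := (g.adj_side hu' (hadj _ _ huw')).resolve_left hw'
    obtain ⟨k, hk⟩ := g.exists_hit_anchor (t := t) hu.2.2.1 hact
    have h1 := hX w w.2 k
    have h2 := hX w' w'.2 k
    apply hlab
    change lab w = lab w'
    grind
  · intro u w hu hw huw
    rcases g.adj_cases (hadj _ _ huw) with h | ⟨i, s, h⟩ | ⟨i, s, h⟩ | ⟨i, s, hact, hs, h⟩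
    · exact ⟨Prod.ext h.1 h.2.1, h.2.2⟩
    · exact absurd h (hu (i, s))
    · exact absurd h (hw (i, s))
    · obtain ⟨k, hk⟩ := g.exists_hit_anchor (t := t) hs hact
      have h1 := hX u u.2 k
      have h2 := hX w w.2 k
      grind
  · intro u w huw h
    rw [Prod.mk.injEq] at huw
    exact hlab (Prod.ext huw.1 (Prod.ext huw.2 h))
  · intro u _
    have hvalid : ∀ w, g.Valid (lab w) ∧ (lab w).1 < n := fun w => (r.range _).1 ⟨w, rfl⟩
    obtain ⟨-, hi⟩ := hvalid u
    have key : ∀ x, (∀ w, w ∉ X → lab w ≠ ((lab u).1, (lab u).2.1, x)) →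
        ∃ x, ∀ w : {w : W // w ∉ X}, (∀ k : ℕ × Slot, w ∉
          (fun u : {w : W // w ∉ X} => lab u.1) ⁻¹' g.side k.1 k.2) →
          ((lab w).1, (lab w).2.1) = ((lab u).1, (lab u).2.1) → (lab w).2.2 ≠ x :=
      fun x hx => ⟨x, fun w _ hwu hwx => by
        rw [Prod.mk.injEq] at hwu
        exact hx w w.2 (Prod.ext hwu.1 (Prod.ext hwu.2 hwx))⟩
    generalize lab u.1 = a at hi key
    obtain ⟨i, s, v⟩ := a
    -- in the slots `lit` and `hub` a vertex is hit, in the other slots the label of `p` is unused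
    have hp : ¬ g.Valid (i, s, g.p) → ∀ w, w ∉ X → lab w ≠ (i, s, g.p) := fun h w _ e =>
      h (e ▸ (hvalid w).1)
    cases s
    case lit => exact key _ fun w hw e => hX w hw (.inl ⟨i, hi⟩) e
    case hub => exact key _ fun w hw e => hX w hw (.inr (.inl ⟨i, hi⟩)) e
    all_goals exact key _ (hp (by simp [Valid]))

theorem Realizes.exists_hitting [Finite V] [Finite W] (r : g.Realizes n G lab) {S : Set W}
    (hH : H.Connected) (hrob : IsRobust α H)
    (hS : ∀ w, w ∈ S ↔ ∃ i, lab w = (i, .lit, g.p)) {v : W} (hv : v ∈ S) :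
    ∃ X : Finset W, X.card = 3 * n - 1 ∧ v ∈ X ∧ ¬ IsMinor H (minus G X) ∧
      IsCompMinor (prune α (minus G X)).coe H ∧
      ∀ d : (minus G (X : Set W)).ConnectedComponent, (∃ s ∈ d.supp, s.1 ∈ S) →
        d.supp.ncard < α ∧ ∃! s, s ∈ d.supp ∧ s.1 ∈ S := by
  classical
  obtain ⟨t, ht⟩ := (hS v).1 hv
  have htn : t < n := by
    have := ((r.range _).1 ⟨v, ht⟩).2
    exact this
  choose x hx using fun k => (r.range (g.hit n t k)).2 (g.valid_hit n t k)
  have hxinj : Function.Injective x := fun k l hkl =>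
    g.hit_injective n t ((hx k).symm.trans ((congrArg lab hkl).trans (hx l)))
  have hX : ∀ w ∉ ((Finset.univ.image x : Finset W) : Set W), ∀ k, lab w ≠ g.hit n t k := by
    intro w hw k hwk
    refine hw ?_
    rw [r.injective (hwk.trans (hx k).symm)]
    simp
  refine ⟨Finset.univ.image x, ?_, ?_, ?_, ?_, ?_⟩
  · rw [Finset.card_image_of_injective _ hxinj]
    simp
    omega
  · refine Finset.mem_image.2 ⟨.inl ⟨t, htn⟩, Finset.mem_univ _, r.injective ?_⟩
    rw [hx, ht]
    simp [hit]
  · exact not_isMinor_of_forall_isRobust hH hrob fun K hK d => (r.component_isMinor hX hK d).2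
  · exact isCompMinor_prune fun K hK d => (r.component_isMinor hX hK d).1
  · rintro d ⟨s, hsd, hsS⟩
    obtain ⟨j, hj⟩ := (hS s).1 hsS
    have hjn : j < n := by
      have := ((r.range _).1 ⟨s.1, hj⟩).2
      exact this
    have hjt : j ≠ t := by
      rintro rfl
      exact hX s s.2 (.inl ⟨j, hjn⟩) (by simp [hj, hit])
    -- the copy of `c` in block `j` is hit, hence the component lies in the copy of `D`
    have hsub : ∀ u ∈ d.supp, ∃ w ∈ g.D, lab u.1 = (j, .lit, w) := fun u hu =>
      mem_of_closed_of_reachable (s := {u | ∃ w ∈ g.D, lab u.1 = (j, .lit, w)})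
        (ConnectedComponent.exact (hsd.trans hu.symm)) ⟨g.p, g.p_mem, hj⟩ <| by
          rintro a ⟨w, hw, haw⟩ b hab
          have hab' : (g.graph n).Adj (lab a.1) (lab b.1) := (r.adj _ _).1 hab
          rw [haw] at hab'
          refine (g.adj_lit hw hab').resolve_right fun hb => ?_
          exact hX b b.2 (.inl ⟨j, hjn⟩) (by simp [hb, hit, hjt])
    constructor
    · have : d.supp.ncard ≤ g.D.ncard := by
        refine Set.ncard_le_ncard_of_injOn (fun u => (lab u.1).2.2) (fun u hu => ?_) ?_
          (Set.toFinite _)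
        · obtain ⟨w, hw, h⟩ := hsub u hu
          simpa [h] using hw
        · intro u hu u' hu' huu'
          obtain ⟨w, hw, h⟩ := hsub u hu
          obtain ⟨w', hw', h'⟩ := hsub u' hu'
          have hww' : w = w' := by simpa [h, h'] using huu'
          exact Subtype.ext (r.injective (by rw [h, h', hww']))
      have := g.ncard_D
      omega
    · refine ⟨s, ⟨hsd, hsS⟩, fun u hu => Subtype.ext (r.injective ?_)⟩
      obtain ⟨i, hi⟩ := (hS u).1 hu.2
      obtain ⟨w, hw, h⟩ := hsub u hu.1
      rw [hj, hi]
      rw [hi] at h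
      simpa using congrArg Prod.fst h

end Frame

end ClauseGadget

namespace ClauseGadget

open MarkedGraph Turing

/-! ### A stack machine that writes down periodic words -/

namespace Printer

/-- The instruction to write the word `1^(b + r) sym`, where `b` is the current base, to one of two
tracks. A conditional instruction is skipped in the last block. -/
structure Instr where
  track : Bool
  offset : ℕ
  sym : Symbol
  cond : Bool

/-- The word that an instruction writes to track `t`. -/
def Instr.out (ins : Instr) (t last : Bool) (b : ℕ) : List Symbol :=
  if ins.track = t ∧ ¬(ins.cond ∧ last) then
    List.replicate (b + ins.offset) Symbol.one ++ [ins.sym]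
  else []

/-- What `k` blocks of the program `prog` write to track `t` when the first block has base `b` and
the base grows by `m` after each block. -/
def blocksOut (prog : List Instr) (m : ℕ) (t : Bool) : ℕ → ℕ → List Symbol
  | 0, _ => []
  | k + 1, b => prog.flatMap (fun ins => ins.out t (k == 0) b) ++ blocksOut prog m t k (b + m)

/-- The stacks of the machine: input, the base in unary, a stack for copying the base, the output,
and the two tracks. -/
inductive Stk
  | inp
  | base
  | tmp
  | out
  | track (t : Bool)
deriving DecidableEq

instance : Fintype Stk :=
  ⟨⟨Multiset.ofList [.inp, .base, .tmp, .out, .track false, .track true], by simp⟩, by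
    rintro (_ | _ | _ | _ | (_ | _)) <;> simp⟩

/-- The control states of the machine, up to the position in the program. -/
inductive Phase
  | next
  | fetch
  | write
  | restore
  | flushTrue
  | flushFalse
  | flushBase

instance : Fintype Phase :=
  ⟨⟨Multiset.ofList [.next, .fetch, .write, .restore, .flushTrue, .flushFalse, .flushBase],
    by simp⟩, by rintro ⟨⟩ <;> simp⟩

instance : Fintype Symbol :=
  ⟨⟨Multiset.ofList [.one, .comma, .semicolon, .bar], by simp⟩, by rintro ⟨⟩ <;> simp⟩

/-- The alphabets of the stacks. -/
abbrev Alph : Stk → Type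
  | .inp => Bool
  | .base => Symbol
  | .tmp => Symbol
  | .out => Symbol
  | .track _ => Symbol

/-- The labels of the machine: a phase and a position in the program. -/
abbrev Lab (prog : List Instr) : Type := Phase × Fin (prog.length + 1)

variable (m : ℕ) (prog : List Instr)

/-- A position in the program as part of a label. -/
def pos (p : ℕ) : Fin (prog.length + 1) := Fin.ofNat _ p

theorem val_pos {p : ℕ} (h : p ≤ prog.length) : (pos prog p : ℕ) = p :=
  Nat.mod_eq_of_lt (Nat.lt_succ_of_le h)

open TM2.Stmt in
/-- Push `r` times the symbol `a`. -/
def pushN (k : Stk) (a : Alph k) (r : ℕ) (q : TM2.Stmt Alph (Lab prog) (Option Symbol)) :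
    TM2.Stmt Alph (Lab prog) (Option Symbol) :=
  (push k fun _ => a)^[r] q

open TM2.Stmt in
/-- The program of the machine. In each block it runs through `prog`; for each instruction the
base is moved to the stack `tmp`, while it is copied to the track, and then moved back. In the end
the tracks, separated by bars, and the base are moved to the output. -/
def machine : Lab prog → TM2.Stmt Alph (Lab prog) (Option Symbol)
  | (.next, _) => pop .inp (fun _ a => a.map fun _ => Symbol.one) <|
      branch Option.isSome (goto fun _ => (.fetch, pos prog 0)) (goto fun _ => (.flushTrue, pos prog 0))
  | (.fetch, p) => match prog[(p : ℕ)]? with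
    | none => pushN prog .base Symbol.one m (goto fun _ => (.next, pos prog 0))
    | some ins => peek .inp (fun _ a => a.map fun _ => Symbol.one) <|
        branch (fun v => ins.cond && v.isNone) (goto fun _ => (.fetch, pos prog (p + 1)))
          (goto fun _ => (.write, p))
  | (.write, p) => match prog[(p : ℕ)]? with
    | none => halt
    | some ins => pop .base (fun _ a => a) <|
        branch Option.isSome
          (push .tmp (fun _ => Symbol.one) <| push (.track ins.track) (fun _ => Symbol.one) <|
            goto fun _ => (.write, p))
          (pushN prog (.track ins.track) Symbol.one ins.offset <|
            push (.track ins.track) (fun _ => ins.sym) <| goto fun _ => (.restore, p))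
  | (.restore, p) => pop .tmp (fun _ a => a) <|
      branch Option.isSome (push .base (fun _ => Symbol.one) <| goto fun _ => (.restore, p))
        (goto fun _ => (.fetch, pos prog (p + 1)))
  | (.flushTrue, _) => pop (.track true) (fun _ a => a) <|
      branch Option.isSome (push .out (fun v => v.getD Symbol.bar) <| goto fun _ => (.flushTrue, pos prog 0))
        (push .out (fun _ => Symbol.bar) <| goto fun _ => (.flushFalse, pos prog 0))
  | (.flushFalse, _) => pop (.track false) (fun _ a => a) <|
      branch Option.isSome (push .out (fun v => v.getD Symbol.bar) <| goto fun _ => (.flushFalse, pos prog 0))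
        (push .out (fun _ => Symbol.bar) <| goto fun _ => (.flushBase, pos prog 0))
  | (.flushBase, _) => pop .base (fun _ a => a) <|
      branch Option.isSome (push .out (fun v => v.getD Symbol.bar) <| goto fun _ => (.flushBase, pos prog 0))
        halt

/-- The bundled machine. -/
def tm : FinTM2 where
  K := Stk
  k₀ := .inp
  k₁ := .out
  Γ := Alph
  Λ := Lab prog
  main := (.next, pos prog 0)
  σ := Option Symbol
  initialState := none
  Γk₀Fin := inferInstanceAs (Fintype Bool)
  m := machine m prog

/-- The contents of all stacks. -/
def stk (inp : List Bool) (base tmp out : List Symbol) (T : Bool → List Symbol) :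
    ∀ k, List (Alph k)
  | .inp => inp
  | .base => base
  | .tmp => tmp
  | .out => out
  | .track t => T t

section update

variable (inp inp' : List Bool) (base tmp out l : List Symbol) (T : Bool → List Symbol) (t : Bool)

@[simp] theorem update_inp :
    Function.update (stk inp base tmp out T) .inp inp' = stk inp' base tmp out T := by
  funext k
  cases k <;> simp [stk, Function.update]

@[simp] theorem update_base :
    Function.update (stk inp base tmp out T) .base l = stk inp l tmp out T := by
  funext k
  cases k <;> simp [stk, Function.update]

@[simp] theorem update_tmp :
    Function.update (stk inp base tmp out T) .tmp l = stk inp base l out T := by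
  funext k
  cases k <;> simp [stk, Function.update]

@[simp] theorem update_out :
    Function.update (stk inp base tmp out T) .out l = stk inp base tmp l T := by
  funext k
  cases k <;> simp [stk, Function.update]

@[simp] theorem update_track :
    Function.update (stk inp base tmp out T) (.track t) l =
      stk inp base tmp out (Function.update T t l) := by
  funext k
  cases k with
  | track t' =>
    by_cases h : t' = t
    · subst h
      simp [stk]
    · simp [stk, Function.update, h]
  | _ => simp [stk, Function.update]

end update

/-- A configuration of the machine. -/
abbrev Conf : Type := TM2.Cfg Alph (Lab prog) (Option Symbol)

/-- The machine gets from `c` to `c'` in at most `B` steps. -/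
def Reach (c c' : Conf prog) (B : ℕ) : Prop :=
  ∃ k ≤ B, (flip bind (TM2.step (machine m prog)))^[k] (some c) = some c'

variable {m prog}

theorem Reach.refl (c : Conf prog) : Reach m prog c c 0 := ⟨0, le_rfl, rfl⟩

theorem Reach.trans {c c' c'' : Conf prog} {B B' : ℕ} (h : Reach m prog c c' B)
    (h' : Reach m prog c' c'' B') : Reach m prog c c'' (B + B') := by
  obtain ⟨k, hk, h⟩ := h
  obtain ⟨k', hk', h'⟩ := h'
  refine ⟨k' + k, by omega, ?_⟩
  rw [Function.iterate_add_apply, h, h']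

theorem Reach.mono {c c' : Conf prog} {B B' : ℕ} (h : Reach m prog c c' B) (hB : B ≤ B') :
    Reach m prog c c' B' := by
  obtain ⟨k, hk, h⟩ := h
  exact ⟨k, hk.trans hB, h⟩

theorem Reach.step {c c' c'' : Conf prog} {B : ℕ} (h : TM2.step (machine m prog) c = some c')
    (h' : Reach m prog c' c'' B) : Reach m prog c c'' (B + 1) := by
  rw [Nat.add_comm]
  exact Reach.trans ⟨1, le_rfl, h⟩ h'

theorem stepAux_pushN (k : Stk) (a : Alph k) (r : ℕ)
    (q : TM2.Stmt Alph (Lab prog) (Option Symbol)) (v : Option Symbol)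
    (S : ∀ k, List (Alph k)) :
    TM2.stepAux (pushN prog k a r q) v S =
      TM2.stepAux q v (Function.update S k (List.replicate r a ++ S k)) := by
  induction r generalizing S with
  | zero => simp [pushN]
  | succ r ih =>
    rw [pushN, Function.iterate_succ_apply', TM2.stepAux, ← pushN, ih]
    simp [List.replicate_succ', List.append_assoc]

variable (prog) in
/-- The configuration with phase `ph` and position `p` in the program, base `b`, and contents `T`
of the tracks. -/
def conf (ph : Phase) (p : ℕ) (v : Option Symbol) (inp : List Bool) (b : ℕ)
    (tmp out : List Symbol) (T : Bool → List Symbol) : Conf prog :=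
  ⟨some (ph, pos prog p), v, stk inp (List.replicate b Symbol.one) tmp out T⟩

section run

variable {p : ℕ} {ins : Instr} (v : Option Symbol) (inp : List Bool) (b : ℕ) (out : List Symbol)
  (T : Bool → List Symbol)

theorem reach_write (hp : prog[p]? = some ins) (j : ℕ) :
    Reach m prog (conf prog .write p v inp b (List.replicate j Symbol.one) out T)
      (conf prog .restore p none inp 0 (List.replicate (b + j) Symbol.one) out
        (Function.update T ins.track
          (ins.sym :: List.replicate (b + ins.offset) Symbol.one ++ T ins.track))) (b + 1) := by
  have hpos : prog[(pos prog p : ℕ)]? = some ins := by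
    rw [val_pos prog (List.getElem?_eq_some_iff.1 hp).1.le, hp]
  induction b generalizing v j T with
  | zero =>
    refine .step ?_ (.refl _)
    simp only [conf, TM2.step, machine, hpos]
    simp [stepAux_pushN, stk]
  | succ b ih =>
    have h := ih (some Symbol.one) (Function.update T ins.track (Symbol.one :: T ins.track)) (j + 1)
    refine .step ?_ (c' := conf prog .write p (some Symbol.one) inp b
      (List.replicate (j + 1) Symbol.one) out
      (Function.update T ins.track (Symbol.one :: T ins.track))) ?_
    rotate_left
    · convert! h using 1
      simp only [Function.update_self, Function.update_idem]
      rw [show b + 1 + j = b + (j + 1) by omega,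
        show b + 1 + ins.offset = b + ins.offset + 1 by omega, List.replicate_succ']
      simp
    · simp only [conf, TM2.step, machine, hpos]
      simp [stk, List.replicate_succ]

theorem reach_restore (hp : p < prog.length) (j : ℕ) :
    Reach m prog (conf prog .restore p v inp b (List.replicate j Symbol.one) out T)
      (conf prog .fetch (p + 1) none inp (b + j) [] out T) (j + 1) := by
  induction j generalizing v b with
  | zero =>
    refine .step ?_ (.refl _)
    simp only [conf, TM2.step, machine]
    simp [stk, val_pos prog hp.le]
  | succ j ih =>
    refine .step ?_ (c' := conf prog .restore p (some Symbol.one) inp (b + 1)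
      (List.replicate j Symbol.one) out T) ?_
    rotate_left
    · rw [show b + (j + 1) = b + 1 + j by omega]
      exact ih _ _
    · simp only [conf, TM2.step, machine]
      simp [stk, List.replicate_succ]

theorem reach_fetch (hp : prog[p]? = some ins) :
    Reach m prog (conf prog .fetch p v inp b [] out T)
      (conf prog .fetch (p + 1) none inp b [] out
        (fun t => (ins.out t inp.isEmpty b).reverse ++ T t)) (2 * b + 3) := by
  have hlt := (List.getElem?_eq_some_iff.1 hp).1
  have hpos : prog[(pos prog p : ℕ)]? = some ins := by rw [val_pos prog hlt.le, hp]
  by_cases hskip : ins.cond ∧ inp.isEmpty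
  · refine (Reach.step (B := 0) ?_ (.refl _)).mono (by omega)
    obtain ⟨h1, h2⟩ := hskip
    obtain rfl : inp = [] := List.isEmpty_iff.1 h2
    simp only [conf, TM2.step, machine, hpos]
    simp [stk, h1, Instr.out, val_pos prog hlt.le]
  · have hT : (fun t => (ins.out t inp.isEmpty b).reverse ++ T t) = Function.update T ins.track
        (ins.sym :: List.replicate (b + ins.offset) Symbol.one ++ T ins.track) := by
      funext t
      by_cases ht : ins.track = t
      · subst ht
        simp only [Instr.out, hskip]
        simp
      · simp [Instr.out, ht, Function.update_of_ne (Ne.symm ht)]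
    rw [hT]
    refine (Reach.step (B := b + 1 + (b + 1)) ?_
      ((reach_write (inp.head?.map fun _ => Symbol.one) inp b out T hp 0).trans
        (by simpa using reach_restore none inp 0 out _ hlt b))).mono (by omega)
    simp only [conf, TM2.step, machine, hpos]
    cases inp <;> simp_all [stk]

theorem reach_block (pre suf : List Instr) (h : prog = pre ++ suf) :
    ∃ v', Reach m prog (conf prog .fetch pre.length v inp b [] out T)
      (conf prog .fetch prog.length v' inp b [] out
        (fun t => (suf.flatMap fun ins => ins.out t inp.isEmpty b).reverse ++ T t))
      (suf.length * (2 * b + 3)) := by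
  induction suf generalizing pre v T with
  | nil =>
    subst h
    exact ⟨v, by simpa using Reach.refl _⟩
  | cons ins suf ih =>
    obtain ⟨v', hv'⟩ := ih none (fun t => (ins.out t inp.isEmpty b).reverse ++ T t) (pre ++ [ins])
      (by simp [h])
    have hp : prog[pre.length]? = some ins := by simp [h]
    refine ⟨v', ?_⟩
    have := (reach_fetch v inp b out T hp (m := m)).trans (by simpa using hv')
    refine (by simpa using this : Reach m prog _ _ _).mono ?_
    rw [List.length_cons]
    exact le_of_eq (by ring)

theorem reach_blocks (k : ℕ) :
    Reach m prog (conf prog .next 0 v (List.replicate k true) b [] out T)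
      (conf prog .flushTrue 0 none [] (b + k * m) [] out
        (fun t => (blocksOut prog m t k b).reverse ++ T t))
      (k * (prog.length * (2 * (b + k * m) + 3) + 2) + 1) := by
  induction k generalizing v b T with
  | zero =>
    refine (Reach.step ?_ (.refl _)).mono (by simp)
    simp only [conf, TM2.step, machine]
    simp [stk, blocksOut]
  | succ k ih =>
    have hemp : (List.replicate k true).isEmpty = (k == 0) := by cases k <;> rfl
    obtain ⟨v', hv'⟩ := reach_block (m := m) (some Symbol.one) (List.replicate k true) b out T
      [] prog rfl
    have h1 : Reach m prog (conf prog .next 0 v (List.replicate (k + 1) true) b [] out T)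
        (conf prog .fetch 0 (some Symbol.one) (List.replicate k true) b [] out T) 1 := by
      refine .step ?_ (.refl _)
      simp only [conf, TM2.step, machine]
      simp [stk, List.replicate_succ]
    have h2 : ∀ T, Reach m prog
        (conf prog .fetch prog.length v' (List.replicate k true) b [] out T)
        (conf prog .next 0 v' (List.replicate k true) (b + m) [] out T) 1 := by
      intro T
      refine .step ?_ (.refl _)
      simp only [conf, TM2.step, machine, val_pos prog le_rfl]
      simp [stk, stepAux_pushN, Nat.add_comm b m]
    have h := (h1.trans hv').trans ((h2 _).trans (ih v' (b + m) _))
    have e1 : b + m + k * m = b + (k + 1) * m := by ring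
    rw [e1] at h
    convert! h.mono (B' := (k + 1) * (prog.length * (2 * (b + (k + 1) * m) + 3) + 2) + 1) ?_ using 2
    · funext t
      simp [blocksOut, hemp]
    · have : prog.length * (2 * b + 3) ≤ prog.length * (2 * (b + (k + 1) * m) + 3) := by
        gcongr
        omega
      linarith [this]

theorem reach_flushTrue (l : List Symbol) (hl : T true = l) :
    Reach m prog (conf prog .flushTrue 0 v inp b [] out T)
      (conf prog .flushFalse 0 none inp b [] (Symbol.bar :: (l.reverse ++ out))
        (Function.update T true [])) (l.length + 1) := by
  induction l generalizing v out T with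
  | nil =>
    refine .step ?_ (.refl _)
    simp only [conf, TM2.step, machine]
    simp [stk, hl]
  | cons a l ih =>
    refine .step ?_ (c' := conf prog .flushTrue 0 (some a) inp b [] (a :: out)
      (Function.update T true l)) ?_
    rotate_left
    · simpa using ih (some a) (a :: out) (Function.update T true l) (by simp)
    · simp only [conf, TM2.step, machine]
      simp [stk, hl]

theorem reach_flushFalse (l : List Symbol) (hl : T false = l) :
    Reach m prog (conf prog .flushFalse 0 v inp b [] out T)
      (conf prog .flushBase 0 none inp b [] (Symbol.bar :: (l.reverse ++ out))
        (Function.update T false [])) (l.length + 1) := by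
  induction l generalizing v out T with
  | nil =>
    refine .step ?_ (.refl _)
    simp only [conf, TM2.step, machine]
    simp [stk, hl]
  | cons a l ih =>
    refine .step ?_ (c' := conf prog .flushFalse 0 (some a) inp b [] (a :: out)
      (Function.update T false l)) ?_
    rotate_left
    · simpa using ih (some a) (a :: out) (Function.update T false l) (by simp)
    · simp only [conf, TM2.step, machine]
      simp [stk, hl]

theorem reach_flushBase :
    Reach m prog (conf prog .flushBase 0 v inp b [] out T)
      ⟨none, none, stk inp [] [] (List.replicate b Symbol.one ++ out) T⟩ (b + 1) := by
  induction b generalizing v out with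
  | zero =>
    refine .step ?_ (.refl _)
    simp only [conf, TM2.step, machine]
    simp [stk]
  | succ b ih =>
    refine .step ?_ (c' := conf prog .flushBase 0 (some Symbol.one) inp b []
      (Symbol.one :: out) T) ?_
    rotate_left
    · rw [List.replicate_succ']
      simpa using ih (some Symbol.one) (Symbol.one :: out)
    · simp only [conf, TM2.step, machine]
      simp [stk, List.replicate_succ]

end run

theorem length_out_le (ins : Instr) (t last : Bool) (b : ℕ) :
    (ins.out t last b).length ≤ b + ins.offset + 1 := by
  unfold Instr.out
  split_ifs <;> simp

variable (m prog) in
theorem length_blocksOut_le (t : Bool) (k b : ℕ) :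
    (blocksOut prog m t k b).length ≤
      k * (prog.length * (b + k * m + 1) + (prog.map Instr.offset).sum) := by
  induction k generalizing b with
  | zero => simp [blocksOut]
  | succ k ih =>
    have h1 : ∀ l : List Instr, (l.flatMap fun ins => ins.out t (k == 0) b).length ≤
        l.length * (b + 1) + (l.map Instr.offset).sum := by
      intro l
      induction l with
      | nil => simp
      | cons ins l ih =>
        simp only [List.flatMap_cons, List.length_append, List.length_cons, List.map_cons,
          List.sum_cons]
        have := length_out_le ins t (k == 0) b
        linarith
    have h2 := ih (b + m)
    have e1 : b + m + k * m = b + (k + 1) * m := by ring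
    rw [e1] at h2
    have h3 : prog.length * (b + 1) ≤ prog.length * (b + (k + 1) * m + 1) := by
      gcongr
      omega
    rw [blocksOut, List.length_append]
    linarith [h1 prog]

/-- The machine prints the base that is reached after `n` blocks, the track `false` and the track
`true`, separated by bars, in polynomial time. -/
theorem nonempty_computable {β : Type} (eb : β → List Symbol) (f : ℕ → β)
    (h : ∀ n, eb (f n) = List.replicate (n * m) Symbol.one ++ Symbol.bar ::
      (blocksOut prog m false n 0 ++ Symbol.bar :: blocksOut prog m true n 0)) :
    Nonempty (TM2ComputableInPolyTime Computability.unaryEncodeNat eb f) := by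
  have hun : ∀ n, Computability.unaryEncodeNat n = List.replicate n true := by
    intro n
    induction n with
    | zero => rfl
    | succ n ih => rw [Computability.unaryEncodeNat, ih, List.replicate_succ]
  let R := (prog.map Instr.offset).sum
  have hrun : ∀ n, Reach m prog (conf prog .next 0 none (List.replicate n true) 0 [] []
      fun _ => []) ⟨none, none, stk [] [] [] (eb (f n)) fun _ => []⟩
      (n * (prog.length * (2 * (n * m) + 3) + 2) + 1 +
        2 * (n * (prog.length * (n * m + 1) + R) + 1) + (n * m + 1)) := by
    intro n
    have h1 := reach_blocks (m := m) (prog := prog) none 0 [] (fun _ => []) n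
    have h2 := reach_flushTrue (m := m) (prog := prog) none [] (0 + n * m) []
      (fun t => (blocksOut prog m t n 0).reverse ++ []) _ rfl
    have h3 := reach_flushFalse (m := m) (prog := prog) none [] (0 + n * m)
      (Symbol.bar :: (((blocksOut prog m true n 0).reverse ++ []).reverse ++ []))
      (Function.update (fun t => (blocksOut prog m t n 0).reverse ++ []) true [])
      ((blocksOut prog m false n 0).reverse) (by simp)
    have h4 := reach_flushBase (m := m) (prog := prog) none [] (0 + n * m)
      (Symbol.bar :: ((blocksOut prog m false n 0).reverse.reverse ++
        Symbol.bar :: (((blocksOut prog m true n 0).reverse ++ []).reverse ++ [])))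
      (Function.update (Function.update
        (fun t => (blocksOut prog m t n 0).reverse ++ []) true []) false [])
    have h5 := ((h1.trans h2).trans h3).trans h4
    have hT : Function.update (Function.update
        (fun t => (blocksOut prog m t n 0).reverse ++ []) true []) false [] = fun _ => [] := by
      funext t
      cases t <;> simp
    rw [hT] at h5
    have hb := fun t => length_blocksOut_le m prog t n 0
    convert! h5.mono (B' := _) ?_ using 2
    · simp [h]
    · simp only [Nat.zero_add, List.append_nil, List.length_reverse] at hb ⊢
      have := hb true
      have := hb false
      simp only [R]
      linarith
  refine ⟨{
    tm := tm m prog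
    inputAlphabet := Equiv.refl Bool
    outputAlphabet := Equiv.refl Symbol
    time := .X * (.C prog.length * (2 * (.X * .C m) + 3) + 2) + 1 +
      2 * (.X * (.C prog.length * (.X * .C m + 1) + .C R) + 1) + (.X * .C m + 1)
    outputsFun := fun n => Classical.choice ?_ }⟩
  obtain ⟨k, hk, hev⟩ := hrun n
  refine ⟨⟨⟨k, ?_⟩, ?_⟩⟩
  · have hin : initList (tm m prog) (List.map (Equiv.refl Bool).invFun
        (Computability.unaryEncodeNat n)) =
        conf prog .next 0 none (List.replicate n true) 0 [] [] fun _ => [] := by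
      rw [hun]
      simp only [conf, initList, tm]
      congr 1
      funext s
      cases s <;> simp [stk]
      rfl
    have hout : haltList (tm m prog) (List.map (Equiv.refl Symbol).invFun (eb (f n))) =
        ⟨none, none, stk [] [] [] (eb (f n)) fun _ => []⟩ := by
      simp only [haltList, tm]
      congr 1
      funext s
      cases s <;> simp [stk]
      rfl
    rw [hin, Option.map_some, hout]
    exact hev
  · refine hk.trans (le_of_eq ?_)
    simp [hun]

end Printer

end ClauseGadget

namespace ClauseGadget

open SimpleGraph MarkedGraph

/-! ### Writing down the gadget -/

namespace Printer

variable (specs : List (Bool × ℕ × ℕ)) (r m : ℕ)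

/-- The edges of `k` blocks of size `m`, the first of which begins at `b`. The edges of a block are
the translates of those in `specs`; the edges with a mark `true` are left out in the last block. -/
def edgesFrom : ℕ → ℕ → List (ℕ × ℕ)
  | 0, _ => []
  | k + 1, b => specs.flatMap (fun e => if e.1 ∧ k == 0 then [] else [(b + e.2.1, b + e.2.2)]) ++
      edgesFrom k (b + m)

/-- The marked vertices of `k` blocks of size `m`, the first of which begins at `b`: the vertex
with number `r` in each block. -/
def marksFrom : ℕ → ℕ → List ℕ
  | 0, _ => []
  | k + 1, b => (b + r) :: marksFrom k (b + m)

/-- The program that writes the edges to the track `false` and the marked vertices to the track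
`true`. -/
def program : List Instr :=
  specs.flatMap (fun e => [⟨false, e.2.1, .comma, e.1⟩, ⟨false, e.2.2, .semicolon, e.1⟩]) ++
    [⟨true, r, .semicolon, false⟩]

theorem mem_edgesFrom {k b : ℕ} {e : ℕ × ℕ} : e ∈ edgesFrom specs m k b ↔
    ∃ i < k, ∃ f ∈ specs, (f.1 = true → i + 1 < k) ∧
      e = (b + i * m + f.2.1, b + i * m + f.2.2) := by
  induction k generalizing b with
  | zero => simp [edgesFrom]
  | succ k ih =>
    rw [edgesFrom, List.mem_append, ih, List.mem_flatMap]
    constructor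
    · rintro (⟨f, hf, he⟩ | ⟨i, hi, f, hf, hl, rfl⟩)
      · refine ⟨0, by omega, f, hf, ?_, ?_⟩
        · intro h
          by_contra hk
          obtain rfl : k = 0 := by omega
          simp [h] at he
        · split_ifs at he
          · simp at he
          · simpa using he
      · exact ⟨i + 1, by omega, f, hf, fun h => by have := hl h; omega, by
          rw [show b + m + i * m = b + (i + 1) * m by ring]⟩
    · rintro ⟨i, hi, f, hf, hl, rfl⟩
      cases i with
      | zero =>
        refine Or.inl ⟨f, hf, ?_⟩
        rw [if_neg]
        · simp
        · rintro ⟨h1, h2⟩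
          have := hl h1
          simp at h2
          omega
      | succ i =>
        exact Or.inr ⟨i, by omega, f, hf, fun h => by have := hl h; omega, by
          rw [show b + m + i * m = b + (i + 1) * m by ring]⟩

theorem mem_marksFrom {k b s : ℕ} : s ∈ marksFrom r m k b ↔ ∃ i < k, s = b + i * m + r := by
  induction k generalizing b with
  | zero => simp [marksFrom]
  | succ k ih =>
    rw [marksFrom, List.mem_cons, ih]
    constructor
    · rintro (rfl | ⟨i, hi, rfl⟩)
      · exact ⟨0, by omega, by simp⟩
      · exact ⟨i + 1, by omega, by ring⟩
    · rintro ⟨i, hi, rfl⟩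
      cases i with
      | zero => exact Or.inl (by simp)
      | succ i => exact Or.inr ⟨i, by omega, by ring⟩

theorem blocksOut_false (k b : ℕ) : blocksOut (program specs r) m false k b =
    (edgesFrom specs m k b).flatMap fun e => List.replicate e.1 Symbol.one ++ [Symbol.comma] ++
      List.replicate e.2 Symbol.one ++ [Symbol.semicolon] := by
  induction k generalizing b with
  | zero => rfl
  | succ k ih =>
    rw [blocksOut, edgesFrom, ih, List.flatMap_append]
    congr 1
    rw [program, List.flatMap_append, List.flatMap_assoc, List.flatMap_assoc]
    simp only [List.flatMap_cons, List.flatMap_nil, List.append_nil, Instr.out, true_and,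
      reduceCtorEq, false_and, if_false]
    congr 1
    funext e
    by_cases h : (e.1 = true ∧ (k == 0) = true)
    · simp only [h]
      simp
    · simp only [h]
      simp

theorem blocksOut_true (k b : ℕ) : blocksOut (program specs r) m true k b =
    (marksFrom r m k b).flatMap fun s => List.replicate s Symbol.one ++ [Symbol.semicolon] := by
  induction k generalizing b with
  | zero => rfl
  | succ k ih =>
    rw [blocksOut, marksFrom, ih, List.flatMap_cons]
    congr 1
    rw [program, List.flatMap_append, List.flatMap_assoc]
    simp [Instr.out]

end Printer

namespace Frame

variable {V : Type*} {H : SimpleGraph V} {α : ℕ} (g : Frame H α)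

theorem copy_eq_shift (i : ℕ) (s : Slot) (v : V) :
    g.copy i s v = (i + (g.copy 0 s v).1, (g.copy 0 s v).2) := by
  cases s <;> simp only [copy] <;> (try split_ifs) <;> simp

/-- The copies that are left out in the last block. -/
def isLink : Slot → Bool
  | .lit | .litAlt | .hub => false
  | .link | .linkLeft | .linkRight => true

theorem active_iff {n i : ℕ} {s : Slot} :
    Active n i s ↔ i < n ∧ (isLink s = true → i + 1 < n) := by
  cases s <;> simp [Active, isLink] <;> omega

/-- A numbering of the valid labels by the natural numbers, block by block. -/
theorem exists_numbering [Finite V] : ∃ (m : ℕ) (num : Label V → ℕ) (lab : ℕ → Label V),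
    (∀ a, g.Valid a → lab (num a) = a) ∧ (∀ w, num (lab w) = w) ∧ (∀ w, g.Valid (lab w)) ∧
      (∀ n a, g.Valid a → (num a < n * m ↔ a.1 < n)) ∧
      ∀ i a, num (i + a.1, a.2) = i * m + num a := by
  classical
  let B := {q : Slot × V // g.Valid (0, q)}
  have hval : ∀ a, g.Valid a ↔ g.Valid (0, a.2) := fun a => Iff.rfl
  let m := Nat.card B
  have hm : 0 < m := Nat.card_pos_iff.2 ⟨⟨⟨(.hub, g.x), trivial⟩⟩, inferInstance⟩
  let e : B ≃ Fin m := Finite.equivFin B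
  let code : Slot × V → ℕ := fun q => if h : g.Valid (0, q) then e ⟨q, h⟩ else 0
  have hcode : ∀ q, code q < m := by
    intro q
    simp only [code]
    split_ifs
    exacts [(e _).2, hm]
  have hdiv : ∀ a : Label V, (a.1 * m + code a.2) / m = a.1 := fun a => by
    rw [Nat.add_comm, Nat.add_mul_div_right _ _ hm, Nat.div_eq_of_lt (hcode _), Nat.zero_add]
  have hmod : ∀ a : Label V, (a.1 * m + code a.2) % m = code a.2 := fun a => by
    rw [Nat.add_comm, Nat.add_mul_mod_self_right, Nat.mod_eq_of_lt (hcode _)]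
  refine ⟨m, fun a => a.1 * m + code a.2, fun w => (w / m, (e.symm ⟨w % m, Nat.mod_lt _ hm⟩).1),
    ?_, ?_, ?_, ?_, ?_⟩
  · intro a ha
    have hc : code a.2 = e ⟨a.2, (hval a).1 ha⟩ := dif_pos ((hval a).1 ha)
    refine Prod.ext (hdiv a) ?_
    have : (⟨(a.1 * m + code a.2) % m, Nat.mod_lt _ hm⟩ : Fin m) = e ⟨a.2, (hval a).1 ha⟩ :=
      Fin.ext ((hmod a).trans hc)
    simp only [this, Equiv.symm_apply_apply]
  · intro w
    have hv := (e.symm ⟨w % m, Nat.mod_lt _ hm⟩).2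
    have hc : code (e.symm ⟨w % m, Nat.mod_lt _ hm⟩).1 = w % m := by
      simp only [code, dif_pos hv]
      simp
    simp only [hc]
    rw [Nat.mul_comm]
    exact Nat.div_add_mod w m
  · exact fun w => (e.symm ⟨w % m, Nat.mod_lt _ hm⟩).2
  · intro n a _
    rw [← Nat.div_lt_iff_lt_mul hm, hdiv]
  · intro i a
    ring

end Frame

/-- The gadgets can be written down in polynomial time. -/
theorem Frame.exists_markedGraph {V : Type*} [Finite V] {H : SimpleGraph V} {α : ℕ}
    (g : Frame H α) :
    ∃ A : ℕ → MarkedGraph,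
      Nonempty (Turing.TM2ComputableInPolyTime Computability.unaryEncodeNat
        MarkedGraph.encode A) ∧
      ∀ n, ∃ lab : Fin (A n).numVerts → Label V, g.Realizes n (A n).graph lab ∧
        ∀ w, w ∈ (A n).markedSet ↔ ∃ i, lab w = (i, .lit, g.p) := by
  classical
  have := Fintype.ofFinite V
  obtain ⟨m, num, lab, hln, hnl, hval, hlt, hshift⟩ := g.exists_numbering
  let specs : List (Bool × ℕ × ℕ) :=
    [Slot.lit, .litAlt, .hub, .link, .linkLeft, .linkRight].flatMap fun s =>
      ((Finset.univ.filter fun e : V × V => H.Adj e.1 e.2).toList).map fun e =>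
        (Frame.isLink s, num (g.copy 0 s e.1), num (g.copy 0 s e.2))
  let r := num (0, .lit, g.p)
  have hcopy : ∀ i s v, num (g.copy i s v) = i * m + num (g.copy 0 s v) := fun i s v => by
    rw [g.copy_eq_shift i s v, hshift]
  have hinj : ∀ a b, g.Valid a → g.Valid b → num a = num b → a = b := fun a b ha hb h => by
    rw [← hln a ha, ← hln b hb, h]
  have hlit : ∀ i, num (i, .lit, g.p) = i * m + r := fun i => hshift i (0, .lit, g.p)
  have hedge : ∀ n e, e ∈ Printer.edgesFrom specs m n 0 ↔ ∃ i s, Frame.Active n i s ∧ ∃ u v,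
      H.Adj u v ∧ e = (num (g.copy i s u), num (g.copy i s v)) := by
    intro n e
    rw [Printer.mem_edgesFrom]
    constructor
    · rintro ⟨i, hi, f, hf, hl, rfl⟩
      obtain ⟨s, -, hf⟩ := List.mem_flatMap.1 hf
      obtain ⟨⟨u, v⟩, huv, rfl⟩ := List.mem_map.1 hf
      refine ⟨i, s, Frame.active_iff.2 ⟨hi, hl⟩, u, v, by simpa using huv, ?_⟩
      rw [hcopy i, hcopy i]
      simp
    · rintro ⟨i, s, hact, u, v, huv, rfl⟩
      obtain ⟨hi, hl⟩ := Frame.active_iff.1 hact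
      refine ⟨i, hi, _, List.mem_flatMap.2 ⟨s, ?_, List.mem_map.2 ⟨(u, v), ?_, rfl⟩⟩, hl, ?_⟩
      · cases s <;> simp
      · simpa using huv
      · rw [hcopy i, hcopy i]
        simp
  have hmark : ∀ n w, w ∈ Printer.marksFrom r m n 0 ↔ ∃ i < n, w = num (i, .lit, g.p) := by
    intro n w
    simp only [Printer.mem_marksFrom, hlit, Nat.zero_add]
  let A : ℕ → MarkedGraph := fun n =>
    { numVerts := n * m
      edges := Printer.edgesFrom specs m n 0
      marked := Printer.marksFrom r m n 0
      edges_lt := by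
        intro e he
        obtain ⟨i, s, hact, u, v, -, rfl⟩ := (hedge n e).1 he
        exact ⟨(hlt n _ (g.valid_copy i s u)).2 (g.copy_fst_lt hact u),
          (hlt n _ (g.valid_copy i s v)).2 (g.copy_fst_lt hact v)⟩
      edges_ne := by
        intro e he h
        obtain ⟨i, s, hact, u, v, huv, rfl⟩ := (hedge n e).1 he
        exact huv.ne (g.copy_injective i s (hinj _ _ (g.valid_copy i s u) (g.valid_copy i s v) h))
      marked_lt := by
        intro w hw
        obtain ⟨i, hi, rfl⟩ := (hmark n w).1 hw
        exact (hlt n (i, .lit, g.p) trivial).2 hi }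
  refine ⟨A, Printer.nonempty_computable (m := m) (prog := Printer.program specs r) _ _
    fun n => ?_, fun n => ⟨fun w => lab w, ⟨?_, ?_, ?_⟩, ?_⟩⟩
  · rw [Printer.blocksOut_false, Printer.blocksOut_true]
    simp [MarkedGraph.encode, A]
  · intro u v huv
    exact Fin.ext ((hnl u).symm.trans ((congrArg num huv).trans (hnl v)))
  · intro a
    constructor
    · rintro ⟨w, rfl⟩
      refine ⟨hval w, (hlt n _ (hval w)).1 ?_⟩
      rw [hnl]
      exact w.2
    · rintro ⟨ha, han⟩
      exact ⟨⟨num a, (hlt n a ha).2 han⟩, hln a ha⟩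
  · intro u v
    rw [MarkedGraph.graph, SimpleGraph.fromRel_adj]
    have hone : ∀ u v : Fin (A n).numVerts, ((u : ℕ), (v : ℕ)) ∈ (A n).edges ↔
        (g.graph n).Adj (lab u) (lab v) := by
      intro u v
      rw [show (A n).edges = Printer.edgesFrom specs m n 0 from rfl, hedge]
      constructor
      · rintro ⟨i, s, hact, a, b, hab, he⟩
        rw [Prod.mk.injEq] at he
        refine ⟨i, s, hact, a, b, hab, ?_, ?_⟩
        · rw [he.1, hln _ (g.valid_copy i s a)]
        · rw [he.2, hln _ (g.valid_copy i s b)]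
      · rintro ⟨i, s, hact, a, b, hab, ha, hb⟩
        exact ⟨i, s, hact, a, b, hab, by rw [ha, hb, hnl, hnl]⟩
    rw [hone, hone]
    constructor
    · rintro ⟨-, h | h⟩
      exacts [h, h.symm]
    · exact fun h => ⟨fun e => h.ne (congrArg (fun w : Fin (A n).numVerts => lab w) e), Or.inl h⟩
  · intro w
    simp only [MarkedGraph.markedSet, Finset.mem_filter, Finset.mem_univ, true_and]
    rw [show (A n).marked = Printer.marksFrom r m n 0 from rfl, hmark]
    constructor
    · rintro ⟨i, -, hi⟩
      exact ⟨i, by rw [hi, hln (i, .lit, g.p) trivial]⟩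
    · rintro ⟨i, hi⟩
      have hw : (w : ℕ) = num (i, .lit, g.p) := by rw [← hi, hnl]
      exact ⟨i, (hlt n (i, .lit, g.p) trivial).1 (hw ▸ w.2), hw⟩

theorem Frame.Realizes.card_marked {V W : Type*} {H : SimpleGraph V} {α n : ℕ} {g : Frame H α}
    {G : SimpleGraph W} {lab : W → Label V} (r : g.Realizes n G lab) {S : Finset W}
    (hS : ∀ w, w ∈ S ↔ ∃ i, lab w = (i, .lit, g.p)) : S.card = n := by
  have hr : ∀ i, (∃ w, lab w = (i, .lit, g.p)) ↔ i < n := fun i => by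
    rw [r.range]
    exact ⟨fun h => h.2, fun h => ⟨trivial, h⟩⟩
  rw [← Finset.card_range n]
  refine Finset.card_bij' (fun w _ => (lab w).1)
    (fun i hi => ((hr i).2 (Finset.mem_range.1 hi)).choose) ?_ ?_ ?_ ?_
  · intro w _
    exact Finset.mem_range.2 ((r.range _).1 ⟨w, rfl⟩).2
  · exact fun i hi => (hS _).2 ⟨i, ((hr i).2 (Finset.mem_range.1 hi)).choose_spec⟩
  · intro w hw
    obtain ⟨i, hi⟩ := (hS w).1 hw
    have h : ∃ w', lab w' = ((lab w).1, .lit, g.p) := ⟨w, by rw [hi]⟩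
    exact r.injective (h.choose_spec.trans (by rw [hi]))
  · intro i hi
    exact congrArg Prod.fst ((hr i).2 (Finset.mem_range.1 hi)).choose_spec

theorem exists_frame {V : Type*} [Finite V] {H : SimpleGraph V} (hH : H.Connected)
    (hcard : 3 ≤ Nat.card V) : Nonempty (Frame H (slb H)) := by
  have := Fintype.ofFinite V
  obtain ⟨c, D, hD, hslb, -⟩ := exists_isFragment_slb hH (by omega)
  obtain ⟨p, hp⟩ := (connected_induce_iff_joinedIn.1 hD.connected).1
  rw [Nat.card_eq_fintype_card] at hcard
  obtain ⟨x, y, z, hxy, hxz, hyz⟩ := Fintype.two_lt_card_iff.1 hcard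
  exact ⟨⟨c, p, x, y, z, D, hD.notMem, hp, hD.closed, hslb, hxy, hyz, hxz⟩⟩

end ClauseGadget

open ClauseGadget
theorem mainTheorem4 {V : Type*} [Finite V] (H : SimpleGraph V) (hconn : H.Connected)
    (hcard : 3 ≤ Nat.card V) :
    ∃ A : ℕ → MarkedGraph,
      -- `A` is computed by a Turing machine that, on input `1^n`, halts within polynomial time
      Nonempty (Turing.TM2ComputableInPolyTime Computability.unaryEncodeNat
        MarkedGraph.encode A) ∧
      ∀ n : ℕ, 1 ≤ n →
        (A n).markedSet.card = n ∧
        treewidth (A n).graph ≤ treewidth H ∧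
        HasPacking H (A n).graph (3 * n - 1) ∧
        HasPacking H (minus (A n).graph (A n).markedSet) (3 * n - 2) ∧
        ∀ v ∈ (A n).markedSet, ∃ X : Finset (Fin (A n).numVerts),
          X.card = 3 * n - 1 ∧
          v ∈ X ∧
          ¬ IsMinor H (minus (A n).graph X) ∧
          IsCompMinor (prune (slb H) (minus (A n).graph X)).coe H ∧
          ∀ c : (minus (A n).graph X).ConnectedComponent,
            (∃ s ∈ c.supp, (s : Fin (A n).numVerts) ∈ (A n).markedSet) →
              c.supp.ncard < slb H ∧
              ∃! s, s ∈ c.supp ∧ (s : Fin (A n).numVerts) ∈ (A n).markedSet := by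
  obtain ⟨g⟩ := exists_frame hconn hcard
  obtain ⟨A, hA, hlab⟩ := g.exists_markedGraph
  refine ⟨A, hA, fun n hn => ?_⟩
  obtain ⟨lab, r, hS⟩ := hlab n
  exact ⟨r.card_marked hS, r.treewidth_le, r.hasPacking hn,
    r.hasPacking_minus hn fun w hw => (hS w).1 hw,
    fun v hv => r.exists_hitting (S := ((A n).markedSet : Set _)) hconn
      (isRobust_slb hconn (by omega)) hS hv⟩
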